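/- Let $d\ge 1$, $a_1,\dots,a_d>0$, $A=(a_1,\dots,a_d)$, $m>0$. For $u>0$ let $n_1(u),\dots,n_d(u)$ be positive integers with $n_i(u)/u\to a_i$ as $u\to\infty$, put $N=N(u)=(n_1(u),\dots,n_d(u))$, and let $\tilde m=\tilde m(u)>0$ satisfy $u\,\tilde m(u)\to m$ as $u\to\infty$. Let $$\Delta^{\tilde m}_{DT_d(N)}f(x)=\sum_{j=1}^d\bigl(2f(x)-f(x+e_j)-f(x-e_j)\bigr)+\tilde m^2f(x)$$ be the massive Laplacian on functions on the discrete torus $DT_d(N)=\prod_{j=1}^d\mathbb Z/n_j\mathbb Z$, and let $\Theta^{\tilde m}_{DT_d(N)}(t)=\sum_\lambda e^{-\lambda t}$, the sum being over its eigenvalues with multiplicity. Put $V_d^{d,N}=\prod_{j=1}^d n_j$, $V_d^d=\prod_{j=1}^d a_j$, let $I_0(x)=\sum_{k\ge0}(x/2)^{2k}/(k!)^2$, and $$\mathcal L_{\tilde m}(0)=-\int_0^\infty\bigl(e^{-\tilde m^2t}e^{-2dt}I_0(2t)^d-e^{-t}\bigr)\frac{dt}{t},$$ $$\mathcal H_{N(u)}(0)=-\int_0^\infty\bigl(\Theta^{\tilde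 m}_{DT_d(N)}(t)-V_d^{d,N}e^{-\tilde m^2t}e^{-2dt}I_0(2t)^d\bigr)\frac{dt}{t}.$$ Let $\Delta_{T_d(A)}+m^2=-\sum_j\partial_j^2+m^2$ on smooth functions on the torus $T_d(A)=\mathbb R^d/\mathrm{diag}(a_1,\dots,a_d)\mathbb Z^d$, let $\theta(t)=\sum_\lambda e^{-\lambda t}$ be the sum over its eigenvalues with multiplicity, and let $\zeta(s)=\Gamma(s)^{-1}\int_0^\infty\theta(t)\,t^{s-1}\,dt$ for $\operatorname{Re}s>d/2$. Then: 1. For every $u>0$ the integrals defining $\mathcal L_{\tilde m}(0)$ and $\mathcal H_{N(u)}(0)$ converge absolutely, $\det\Delta^{\tilde m}_{DT_d(N)}>0$, and $$\log\det\Delta^{\tilde m}_{DT_d(N)}=V_d^{d,N}\,\mathcal L_{\tilde m}(0)+\mathcal H_{N(u)}(0).$$ 2. All eigenvalues of $\Delta_{T_d(A)}+m^2$ have finite multiplicity, the series $\theta(t)$ converges for $t>0$, the integral defining $\zeta(s)$ converges absolutely for $\operatorname{Re}s>d/2$, and $\zeta$ has a meromorphic continuation to $\mathbb C$ that is holomorphic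 at $0$; put $\log\det_\zeta(\Delta_{T_d(A)}+m^2)=-\zeta'(0)$. 3. As $u\to\infty$, $$\mathcal H_{N(u)}(0)=\log{\det}_\zeta(\Delta_{T_d(A)}+m^2)+C_d+o(1),$$ where $$C_d=\frac{V_d^d}{(4\pi/m^2)^{d/2}}\,\Gamma(-d/2)\quad(d\text{ odd}),$$ $$C_d=(-1)^{d/2}\,\frac{\sum_{k=1}^{d/2}\frac1k-\log(m^2)}{(d/2)!}\,\frac{V_d^d}{(4\pi)^{d/2}}\,m^d\quad(d\text{ even}).$$ -/

import Mathlib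

open Filter Topology MeasureTheory Set
open scoped ContDiff

noncomputable section

namespace MassiveTorus

/-- The modified Bessel function of the first kind of order zero,
`I₀(x) = ∑ₖ (x/2)^(2k) / (k!)²`. -/
def besselI0 (x : ℝ) : ℝ := ∑' k : ℕ, (x / 2) ^ (2 * k) / (k.factorial : ℝ) ^ 2

/-- The theta function (trace of the heat kernel) of a linear operator `T` with real spectrum:
the sum of `exp (-lam * t)` over the eigenvalues `lam` of `T`, counted with multiplicity. -/
def theta {V : Type*} [AddCommGroup V] [Module ℂ V] (T : Module.End ℂ V) (t : ℝ) : ℝ :=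
  ∑' lam : ℝ, (Module.finrank ℂ (T.eigenspace (lam : ℂ)) : ℝ) * Real.exp (-(lam * t))

section Discrete

variable {d : ℕ}

/-- The discrete torus `∏ j, ℤ/n_jℤ`. -/
abbrev DiscreteTorus (N : Fin d → ℕ) : Type := ∀ j, ZMod (N j)

/-- The massive Laplacian `Δ + mu²` on the discrete torus, acting on functions; `Δ f (x)` is the
sum over the `2d` nearest neighbours `x ± e_j` of `f (x) - f (x ± e_j)`. -/
def discreteLaplacian (N : Fin d → ℕ) (mu : ℝ) : Module.End ℂ (DiscreteTorus N → ℂ) where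
  toFun f := fun x =>
    (∑ j, ((f x - f (x + Pi.single j 1)) + (f x - f (x - Pi.single j 1)))) + (mu : ℂ) ^ 2 * f x
  map_add' f g := by
    funext x
    simp only [Pi.add_apply, Finset.sum_add_distrib, Finset.sum_sub_distrib]
    ring
  map_smul' c f := by
    funext x
    simp only [Pi.smul_apply, smul_eq_mul, RingHom.id_apply, mul_add, Finset.mul_sum, mul_sub]
    ring

/-- The integrand (with respect to `dt` on `(0, ∞)`) of the bulk term. -/
def bulkIntegrand (d : ℕ) (mu t : ℝ) : ℝ :=
  (Real.exp (-(mu ^ 2 * t)) * Real.exp (-(2 * d * t)) * besselI0 (2 * t) ^ d - Real.exp (-t)) / t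

/-- `𝓛_mu(0) = -∫₀^∞ (e^{-mu² t} e^{-2dt} I₀(2t)^d - e^{-t}) dt/t`. -/
def bulk (d : ℕ) (mu : ℝ) : ℝ := -∫ t in Ioi (0 : ℝ), bulkIntegrand d mu t

/-- The integrand (with respect to `dt` on `(0, ∞)`) of the remaining term. -/
def remainderIntegrand (N : Fin d → ℕ) (mu t : ℝ) : ℝ :=
  (theta (discreteLaplacian N mu) t -
    (∏ j, (N j : ℝ)) *
      (Real.exp (-(mu ^ 2 * t)) * Real.exp (-(2 * d * t)) * besselI0 (2 * t) ^ d)) / t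

/-- `𝓗_N(0) = -∫₀^∞ (Θ(t) - (∏ n_j) e^{-mu² t} e^{-2dt} I₀(2t)^d) dt/t`. -/
def remainder (N : Fin d → ℕ) (mu : ℝ) : ℝ := -∫ t in Ioi (0 : ℝ), remainderIntegrand N mu t

end Discrete

section Continuous

variable {d : ℕ}

/-- Smooth complex functions on the torus `ℝ^d / diag(a₁, …, a_d) ℤ^d`, viewed as smooth functions
on `ℝ^d` that are periodic with period `a_j` in the `j`-th coordinate. -/
def smoothTorusFunctions (a : Fin d → ℝ) : Submodule ℂ (EuclideanSpace ℝ (Fin d) → ℂ) where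
  carrier := {f | ContDiff ℝ ∞ f ∧ ∀ j x, f (x + EuclideanSpace.single j (a j)) = f x}
  add_mem' := by
    rintro f g ⟨hf, hf'⟩ ⟨hg, hg'⟩
    exact ⟨hf.add hg, fun j x => by simp only [Pi.add_apply, hf', hg']⟩
  zero_mem' := ⟨contDiff_const, fun _ _ => rfl⟩
  smul_mem' := by
    rintro c f ⟨hf, hf'⟩
    exact ⟨hf.const_smul c, fun j x => by simp only [Pi.smul_apply, hf']⟩

theorem two_le_infty : (2 : WithTop ℕ∞) ≤ ∞ :=
  WithTop.coe_le_coe.2 (le_top : (2 : ℕ∞) ≤ ⊤)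

/-- Translates of smooth functions have translated Laplacians, and the Laplacian preserves
smoothness, so it acts on smooth functions on the torus. -/
theorem laplacian_mem_smoothTorusFunctions (a : Fin d → ℝ) {f : EuclideanSpace ℝ (Fin d) → ℂ}
    (hf : f ∈ smoothTorusFunctions a) : Laplacian.laplacian f ∈ smoothTorusFunctions a := by
  obtain ⟨hf, hp⟩ := hf
  rw [InnerProductSpace.laplacian_eq_iteratedFDeriv_stdOrthonormalBasis]
  refine ⟨?_, fun j x => ?_⟩
  · refine ContDiff.sum fun i _ => ?_
    have h : ContDiff ℝ ∞ (iteratedFDeriv ℝ 2 f) :=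
      hf.iteratedFDeriv_right (le_of_eq rfl)
    exact (ContinuousMultilinearMap.apply ℝ _ ℂ _).contDiff.comp h
  · have h : (fun y => f (y + EuclideanSpace.single j (a j))) = f := funext fun y => hp j y
    have h2 := iteratedFDeriv_comp_add_right (𝕜 := ℝ) (f := f) 2
      (EuclideanSpace.single j (a j)) x
    rw [h] at h2
    simp only [h2]

/-- The massive Laplacian `-∑ ∂_j² + m²` of the flat torus, on smooth functions. -/
def torusLaplacian (a : Fin d → ℝ) (m : ℝ) : Module.End ℂ (smoothTorusFunctions a) where
  toFun f :=
    -⟨Laplacian.laplacian (f : EuclideanSpace ℝ (Fin d) → ℂ),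
      laplacian_mem_smoothTorusFunctions a f.2⟩ + ((m : ℂ) ^ 2) • f
  map_add' f g := by
    ext x
    have h := ContDiffAt.laplacian_add (x := x) (f.2.1.of_le two_le_infty).contDiffAt
      (g.2.1.of_le two_le_infty).contDiffAt
    simp [h]
    ring
  map_smul' c f := by
    ext x
    have h := InnerProductSpace.laplacian_smul (x := x) c (f.2.1.of_le two_le_infty).contDiffAt
    simp [h]
    ring

/-- `Z` is the meromorphic continuation to `ℂ`, regular at `0`, of the spectral zeta function
`ζ(s) = Γ(s)⁻¹ ∫₀^∞ θ(t) t^{s-1} dt`, `Re s > d/2`, of the massive Laplacian of the torus. -/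
def IsTorusZeta (a : Fin d → ℝ) (m : ℝ) (Z : ℂ → ℂ) : Prop :=
  MeromorphicOn Z univ ∧ AnalyticAt ℂ Z 0 ∧
    ∀ s : ℂ, (d : ℝ) / 2 < s.re →
      Z s = 1 / Complex.Gamma s * mellin (fun t => (theta (torusLaplacian a m) t : ℂ)) s

/-- The (continued) spectral zeta function of the massive Laplacian of the torus. -/
def torusZeta (a : Fin d → ℝ) (m : ℝ) : ℂ → ℂ := Classical.epsilon (IsTorusZeta a m)

/-- The logarithm of the zeta-regularized determinant of the massive Laplacian of the torus,
`log det_ζ = -ζ'(0)`. -/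
def torusLogDet (a : Fin d → ℝ) (m : ℝ) : ℂ := -deriv (torusZeta a m) 0

/-- The explicit constant in the asymptotics. -/
def explicitTerm (a : Fin d → ℝ) (m : ℝ) : ℝ :=
  if Odd d then
    (∏ j, a j) / (4 * Real.pi / m ^ 2) ^ ((d : ℝ) / 2) * Real.Gamma (-(d : ℝ) / 2)
  else
    (-1) ^ (d / 2) *
      (((∑ k ∈ Finset.Icc 1 (d / 2), 1 / (k : ℝ)) - Real.log (m ^ 2)) / ((d / 2).factorial : ℝ)) *
      ((∏ j, a j) / (4 * Real.pi) ^ (d / 2)) * m ^ d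

end Continuous

end MassiveTorus

end

/-! The heat trace of the discrete torus factors as $e^{-\tilde m^2t}$ times a product of theta
functions of cycles. In the bulk part each of these is replaced by $n_j$ times the heat kernel
$p(t)=e^{-2t}I_0(2t)$ of ℤ. The exact formula comes from Frullani's integral
$\int_0^\infty(e^{-\lambda t}-e^{-t})\,dt/t=-\log\lambda$ summed over the $\prod n_j$ eigenvalues:
the subtracted exponentials are exactly those in the bulk integral (`remainderIntegrand_eq_sum`,
`bulk_add_remainder`).

For the asymptotics, substitute $t\mapsto u^2t$, which preserves $dt/t$, and use dominated
convergence. Two facts are needed about the defect, the product of cycle theta functions minus its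
bulk part.

Domination: expanding the exponentials and summing over $n$-th roots of unity writes the cycle theta
function as $n p(t)$ plus nonnegative terms $t^{i+j}/(i!\,j!)$, up to a common factor, with $n\mid
i-j\ne0$. Weighting by $r^{\pm(i-j)}$ with $r=1+1/\sqrt t$ bounds this excess by $2e\,r^{-n}$ times
the theta function (`cycleTheta_sub_le`). After rescaling, the defect is bounded uniformly in $u$ by
any prescribed power of $t$, times $(1+t)^d$ (`eventually_discreteDefect_le`).

Pointwise limit: the cycle theta function tends to the circle theta function (`tendsto_cycleTheta`),
and $u\,p(u^2)\to(4\pi)^{-1/2}$ (`tendsto_mul_latticeKernel`). The second limit is squeezed out of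
the same aliasing bound, applied to cycles of length $K\lceil u\rceil$, and Poisson summation. So
the remainder tends to $-\int_0^\infty e^{-m^2t}D(t)\,dt/t$, where $D$ is the massless torus theta
function minus $\prod_j a_j/\sqrt{4\pi t}$ (`tendsto_remainder`).

On the continuous side, the Mellin transform of $e^{-m^2t}D(t)$ is entire, and the subtracted term
contributes $m^{d-2s}\,\Gamma(s-d/2)/\Gamma(s)$ times a constant to ζ. As $1/\Gamma$ vanishes at 0
with derivative 1, $\zeta'(0)$ is the same integral plus the derivative of the Gamma quotient term,
which is $C_d$ (`deriv_continuedZeta`). Comparing the two expressions finishes the proof. -/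

noncomputable section

namespace MassiveTorus

/-! ### Theta functions from explicit eigenvectors -/

section Spectrum

variable {V ι : Type*} [AddCommGroup V] [Module ℂ V]

/-- If the eigenvectors `e i` are independent and span every eigenspace, the multiplicity of an
eigenvalue is the number of indices carrying it. -/
theorem finrank_eigenspace_eq_card (T : Module.End ℂ V) (e : ι → V) (μ : ι → ℝ)
    (he : LinearIndependent ℂ e) (hT : ∀ i, T (e i) = (μ i : ℂ) • e i)
    (hfin : ∀ lam : ℝ, Finite {i // μ i = lam})
    (hspan : ∀ (lam : ℝ) (v : V), T v = (lam : ℂ) • v →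
      v ∈ Submodule.span ℂ (range fun i : {i // μ i = lam} => e i)) (lam : ℝ) :
    FiniteDimensional ℂ (T.eigenspace (lam : ℂ)) ∧
      Module.finrank ℂ (T.eigenspace (lam : ℂ)) = Nat.card {i // μ i = lam} := by
  have h : T.eigenspace (lam : ℂ) = Submodule.span ℂ (range fun i : {i // μ i = lam} => e i) := by
    apply le_antisymm
    · intro v hv
      exact hspan lam v (Module.End.mem_eigenspace_iff.1 hv)
    · rw [Submodule.span_le]
      rintro _ ⟨⟨i, hi⟩, rfl⟩
      exact Module.End.mem_eigenspace_iff.2 (hi ▸ hT i)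
  have := hfin lam
  have := Fintype.ofFinite {i // μ i = lam}
  rw [h]
  refine ⟨FiniteDimensional.span_of_finite ℂ (finite_range _), ?_⟩
  rw [Nat.card_eq_fintype_card]
  exact finrank_span_eq_card (he.comp _ Subtype.val_injective)

/-- Group the indices by the fibres of `μ`: each fibre is finite and contributes its cardinality,
the multiplicity, times one exponential. Reals that are not eigenvalues have empty fibres, so the
sum may run over all of ℝ. -/
theorem hasSum_theta_of_hasSum (T : Module.End ℂ V) (μ : ι → ℝ)
    (hfin : ∀ lam : ℝ, Finite {i // μ i = lam})
    (hcard : ∀ lam : ℝ, Module.finrank ℂ (T.eigenspace (lam : ℂ)) = Nat.card {i // μ i = lam})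
    {t S : ℝ} (hS : HasSum (fun i => Real.exp (-(μ i * t))) S) :
    HasSum (fun lam : ℝ =>
      (Module.finrank ℂ (T.eigenspace (lam : ℂ)) : ℝ) * Real.exp (-(lam * t))) S := by
  rw [← (Equiv.sigmaFiberEquiv μ).hasSum_iff] at hS
  refine hS.sigma fun lam => ?_
  have := hfin lam
  have := Fintype.ofFinite {i // μ i = lam}
  have h := hasSum_fintype fun i : {i // μ i = lam} => Real.exp (-(μ i * t))
  have h2 : ∑ i : {i // μ i = lam}, Real.exp (-(μ i * t)) =
      Module.finrank ℂ (T.eigenspace (lam : ℂ)) * Real.exp (-(lam * t)) := by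
    rw [hcard lam, Nat.card_eq_fintype_card, Finset.sum_congr rfl fun i _ => by rw [i.2]]
    simp
  rw [← h2]
  exact h

theorem theta_eq_of_hasSum (T : Module.End ℂ V) (μ : ι → ℝ)
    (hfin : ∀ lam : ℝ, Finite {i // μ i = lam})
    (hcard : ∀ lam : ℝ, Module.finrank ℂ (T.eigenspace (lam : ℂ)) = Nat.card {i // μ i = lam})
    {t S : ℝ} (hS : HasSum (fun i => Real.exp (-(μ i * t))) S) : theta T t = S :=
  (hasSum_theta_of_hasSum T μ hfin hcard hS).tsum_eq

end Spectrum

/-! ### Diagonalization on the discrete torus by characters -/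

section DiscreteSpectrum

/-- The eigenvalues `2 - 2 cos (2πk/n)` of the Laplacian of the cycle of length `n`. -/
def cycleEigenvalue (n k : ℕ) : ℝ := 2 - 2 * Real.cos (2 * Real.pi * (k / n))

/-- The theta function of the cycle of length `n`. -/
def cycleTheta (n : ℕ) (t : ℝ) : ℝ :=
  ∑ k ∈ Finset.range n, Real.exp (-(t * cycleEigenvalue n k))

theorem sum_zmod_val {M : Type*} [AddCommMonoid M] (n : ℕ) [NeZero n] (f : ℕ → M) :
    ∑ k : ZMod n, f k.val = ∑ k ∈ Finset.range n, f k := by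
  refine Finset.sum_bij (fun k _ => k.val) (fun k _ => Finset.mem_range.2 k.val_lt)
    (fun _ _ _ _ h => ZMod.val_injective n h) (fun k hk => ?_) fun _ _ => rfl
  exact ⟨(k : ZMod n), Finset.mem_univ _, ZMod.val_cast_of_lt (Finset.mem_range.1 hk)⟩

/-- The eigenvalues of the massive Laplacian of the discrete torus. -/
def discreteEigenvalue {d : ℕ} (N : Fin d → ℕ) (mu : ℝ) (k : DiscreteTorus N) : ℝ :=
  (∑ j, cycleEigenvalue (N j) (k j).val) + mu ^ 2

theorem cycleEigenvalue_nonneg (n k : ℕ) : 0 ≤ cycleEigenvalue n k := by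
  have := Real.cos_le_one (2 * Real.pi * (k / n))
  unfold cycleEigenvalue
  linarith

theorem discreteEigenvalue_pos {d : ℕ} (N : Fin d → ℕ) {mu : ℝ} (hmu : 0 < mu) (k : DiscreteTorus N) :
    0 < discreteEigenvalue N mu k :=
  add_pos_of_nonneg_of_pos (Finset.sum_nonneg fun _ _ => cycleEigenvalue_nonneg _ _) (by positivity)

variable {d : ℕ} (N : Fin d → ℕ) [∀ j, NeZero (N j)]

/-- The character of the discrete torus of frequency `k`. -/
def torusChar (k : DiscreteTorus N) : AddChar (DiscreteTorus N) ℂ where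
  toFun x := ∏ j, (AddChar.zmod (N j) (k j) (x j) : ℂ)
  map_zero_eq_one' := by simp
  map_add_eq_mul' x y := by simp [AddChar.map_add_eq_mul, Finset.prod_mul_distrib]

theorem torusChar_single (k : DiscreteTorus N) (j : Fin d) (y : ZMod (N j)) :
    torusChar N k (Pi.single j y) = AddChar.zmod (N j) (k j) y := by
  change ∏ i, (AddChar.zmod (N i) (k i) ((Pi.single j y : DiscreteTorus N) i) : ℂ) = _
  rw [Finset.prod_eq_single j]
  · simp
  · intro i _ hi
    simp [Pi.single_eq_of_ne hi]
  · simp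

theorem torusChar_injective : Function.Injective (torusChar N) := by
  intro k l h
  funext j
  refine AddChar.zmod_injective (DFunLike.ext _ _ fun y => ?_)
  have := DFunLike.congr_fun h (Pi.single j y)
  rw [torusChar_single, torusChar_single] at this
  exact Circle.ext this

/-- Euler's formula: the two character values are $e^{\pm2\pi ik/n}$. This is the eigenvalue
contributed by one coordinate direction. -/
theorem two_sub_zmod_one (n : ℕ) [NeZero n] (k : ZMod n) :
    (1 - (AddChar.zmod n k 1 : ℂ)) + (1 - (AddChar.zmod n k (-1) : ℂ)) =
      (cycleEigenvalue n k.val : ℂ) := by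
  have hk : ((k.val : ℤ) : ZMod n) = k := by simp
  have h := AddChar.zmod_intCast n k.val 1
  have h' := AddChar.zmod_intCast n k.val (-1)
  rw [hk, Int.cast_one] at h
  rw [hk, Int.cast_neg, Int.cast_one] at h'
  rw [h, h', Circle.coe_exp, Circle.coe_exp, cycleEigenvalue]
  push_cast
  rw [Complex.cos]
  ring_nf

theorem discreteLaplacian_torusChar (mu : ℝ) (k : DiscreteTorus N) :
    discreteLaplacian N mu (torusChar N k) =
      (discreteEigenvalue N mu k : ℂ) • (torusChar N k : DiscreteTorus N → ℂ) := by
  funext x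
  change (∑ j, ((torusChar N k x - torusChar N k (x + Pi.single j 1)) +
    (torusChar N k x - torusChar N k (x - Pi.single j 1)))) + (mu : ℂ) ^ 2 * torusChar N k x =
    (discreteEigenvalue N mu k : ℂ) * torusChar N k x
  simp only [sub_eq_add_neg x, ← Pi.single_neg, AddChar.map_add_eq_mul, torusChar_single]
  rw [discreteEigenvalue]
  push_cast
  rw [add_mul, Finset.sum_mul]
  congr 1
  refine Finset.sum_congr rfl fun j _ => ?_
  rw [← two_sub_zmod_one]
  ring

/-- The characters form a basis of the functions on the discrete torus. -/
def torusCharBasis : Module.Basis (DiscreteTorus N) ℂ (DiscreteTorus N → ℂ) :=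
  basisOfLinearIndependentOfCardEqFinrank
    ((AddChar.linearIndependent (DiscreteTorus N) ℂ).comp _ (torusChar_injective N)) (by simp)

theorem torusCharBasis_apply (k : DiscreteTorus N) : torusCharBasis N k = torusChar N k := by
  simp [torusCharBasis]

theorem det_discreteLaplacian (mu : ℝ) :
    LinearMap.det (discreteLaplacian N mu) =
      ((∏ k : DiscreteTorus N, discreteEigenvalue N mu k : ℝ) : ℂ) := by
  classical
  rw [← LinearMap.det_toMatrix (torusCharBasis N)]
  have : LinearMap.toMatrix (torusCharBasis N) (torusCharBasis N) (discreteLaplacian N mu) =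
      Matrix.diagonal fun k => (discreteEigenvalue N mu k : ℂ) := by
    ext i k
    rw [LinearMap.toMatrix_apply, torusCharBasis_apply, discreteLaplacian_torusChar,
      ← torusCharBasis_apply, map_smul, Module.Basis.repr_self, Matrix.diagonal_apply]
    simp only [Finsupp.smul_single, smul_eq_mul, mul_one, Finsupp.single_apply]
    by_cases h : k = i
    · simp [h]
    · simp [h, Ne.symm h]
  rw [this, Matrix.det_diagonal]
  push_cast
  rfl

theorem theta_discreteLaplacian (mu t : ℝ) :
    theta (discreteLaplacian N mu) t =
      ∑ k : DiscreteTorus N, Real.exp (-(discreteEigenvalue N mu k * t)) := by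
  have hT : ∀ k, discreteLaplacian N mu (torusCharBasis N k) =
      (discreteEigenvalue N mu k : ℂ) • torusCharBasis N k := fun k => by
    rw [torusCharBasis_apply, discreteLaplacian_torusChar]
  refine theta_eq_of_hasSum _ (discreteEigenvalue N mu) (fun _ => inferInstance)
    (fun lam => (finrank_eigenspace_eq_card _ (torusCharBasis N) _
      (torusCharBasis N).linearIndependent hT (fun _ => inferInstance) (fun lam v hv => ?_) lam).2)
    (hasSum_fintype _)
  -- Comparing coordinates in $Tv=\lambda v$: every basis vector that occurs in `v` has eigenvalue
  -- `lam`, which puts `v` in the required span.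
  have hc : ∀ k, (torusCharBasis N).repr v k ≠ 0 → discreteEigenvalue N mu k = lam := by
    intro k hk
    have h1 : (torusCharBasis N).repr (discreteLaplacian N mu v) k =
        (discreteEigenvalue N mu k : ℂ) * (torusCharBasis N).repr v k := by
      conv_lhs => rw [← (torusCharBasis N).sum_repr v]
      simp only [map_sum, map_smul, hT, Module.Basis.repr_self, Finsupp.smul_single, smul_eq_mul,
        Finsupp.coe_finsetSum, Finset.sum_apply, mul_one]
      rw [Finset.sum_eq_single k]
      · simp [mul_comm]
      · intro b _ hb
        simp [hb]
      · simp
    rw [hv, map_smul, Finsupp.smul_apply, smul_eq_mul] at h1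
    exact_mod_cast (mul_right_cancel₀ hk h1).symm
  rw [← (torusCharBasis N).sum_repr v]
  refine Submodule.sum_mem _ fun k _ => ?_
  by_cases h : (torusCharBasis N).repr v k = 0
  · simp [h]
  · exact Submodule.smul_mem _ _ (Submodule.subset_span ⟨⟨k, hc k h⟩, rfl⟩)

theorem sum_exp_discreteEigenvalue (mu t : ℝ) :
    ∑ k : DiscreteTorus N, Real.exp (-(discreteEigenvalue N mu k * t)) =
      Real.exp (-(mu ^ 2 * t)) * ∏ j, cycleTheta (N j) t := by
  simp only [cycleTheta, ← sum_zmod_val]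
  rw [Finset.prod_univ_sum, Finset.mul_sum, Fintype.piFinset_univ]
  refine Finset.sum_congr rfl fun k _ => ?_
  rw [← Real.exp_sum, ← Real.exp_add, discreteEigenvalue, Finset.sum_neg_distrib,
    ← Finset.mul_sum]
  ring_nf

end DiscreteSpectrum


/-! ### The heat kernel of ℤ and the aliasing formula -/

/-- The heat kernel `e^{-2t} I₀(2t)` of `ℤ` on the diagonal. -/
def latticeKernel (t : ℝ) : ℝ := Real.exp (-(2 * t)) * besselI0 (2 * t)

section Aliasing

/-- Orthogonality of characters: a geometric series whose ratio $\zeta^{i-j}$ is an $n$-th root of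
unity, trivial exactly when $n\mid i-j$. -/
theorem sum_pow_mul_conj_pow (n : ℕ) [NeZero n] (i j : ℕ) :
    ∑ k ∈ Finset.range n, (Complex.exp (2 * Real.pi * Complex.I * (k / n))) ^ i *
      (Complex.exp (-(2 * Real.pi * Complex.I * (k / n)))) ^ j =
      if (n : ℤ) ∣ (i : ℤ) - j then (n : ℂ) else 0 := by
  set ζ : ℂ := Complex.exp (2 * Real.pi * Complex.I / n) with hζ
  have hprim : IsPrimitiveRoot ζ n := Complex.isPrimitiveRoot_exp n (NeZero.ne n)
  have hterm : ∀ k : ℕ, (Complex.exp (2 * Real.pi * Complex.I * (k / n))) ^ i *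
      (Complex.exp (-(2 * Real.pi * Complex.I * (k / n)))) ^ j = (ζ ^ ((i : ℤ) - j)) ^ k := by
    intro k
    rw [hζ, ← Complex.exp_int_mul, ← Complex.exp_nat_mul, ← Complex.exp_nat_mul,
      ← Complex.exp_nat_mul, ← Complex.exp_add]
    push_cast
    ring_nf
  simp only [hterm]
  by_cases h : (n : ℤ) ∣ (i : ℤ) - j
  · simp [(hprim.zpow_eq_one_iff_dvd _).2 h, h]
  · have h1 : ζ ^ ((i : ℤ) - j) ≠ 1 := fun h' => h ((hprim.zpow_eq_one_iff_dvd _).1 h')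
    rw [if_neg h, geom_sum_eq h1, ← zpow_natCast, ← zpow_mul, mul_comm, zpow_mul, zpow_natCast,
      hprim.pow_eq_one]
    simp

/-- The coefficients of the product of the exponential series of `t r w` and `t r⁻¹ w⁻¹`. -/
def tiltedCoeff (t r : ℝ) (p : ℕ × ℕ) : ℝ :=
  (t * r) ^ p.1 / p.1.factorial * ((t * r⁻¹) ^ p.2 / p.2.factorial)

theorem tiltedCoeff_nonneg {t r : ℝ} (ht : 0 ≤ t) (hr : 0 ≤ r) (p : ℕ × ℕ) :
    0 ≤ tiltedCoeff t r p := by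
  unfold tiltedCoeff
  positivity

theorem hasSum_exp_series (w : ℂ) :
    HasSum (fun n : ℕ => w ^ n / (n.factorial : ℂ)) (Complex.exp w) := by
  rw [Complex.exp_eq_exp_ℂ]
  exact NormedSpace.expSeries_div_hasSum_exp w

theorem summable_norm_exp_series (w : ℂ) :
    Summable fun n : ℕ => ‖w ^ n / (n.factorial : ℂ)‖ :=
  NormedSpace.norm_expSeries_div_summable w

theorem hasSum_mul_of_summable_norm {f g : ℕ → ℂ} {w v : ℂ} (hw : HasSum f w) (hv : HasSum g v)
    (hf : Summable fun n => ‖f n‖) (hg : Summable fun n => ‖g n‖) :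
    HasSum (fun p : ℕ × ℕ => f p.1 * g p.2) (w * v) :=
  hw.mul hv (summable_mul_of_summable_norm hf hg)

theorem hasSum_tilted_exp (t r : ℝ) (z : ℂ) :
    HasSum (fun p : ℕ × ℕ => (tiltedCoeff t r p : ℂ) *
        (Complex.exp z ^ p.1 * Complex.exp (-z) ^ p.2))
      (Complex.exp (t * r * Complex.exp z + t * r⁻¹ * Complex.exp (-z))) := by
  rw [Complex.exp_add]
  have h3 := hasSum_mul_of_summable_norm (hasSum_exp_series (t * r * Complex.exp z))
    (hasSum_exp_series (t * r⁻¹ * Complex.exp (-z))) (summable_norm_exp_series _)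
    (summable_norm_exp_series _)
  have h4 : (fun p : ℕ × ℕ => (tiltedCoeff t r p : ℂ) *
      (Complex.exp z ^ p.1 * Complex.exp (-z) ^ p.2)) = fun p : ℕ × ℕ =>
      (t * r * Complex.exp z) ^ p.1 / p.1.factorial *
        ((t * r⁻¹ * Complex.exp (-z)) ^ p.2 / p.2.factorial) := by
    funext p
    rw [tiltedCoeff, mul_pow (_ * _) (Complex.exp z), mul_pow (_ * _) (Complex.exp (-z))]
    push_cast
    ring
  rw [h4]
  exact h3

/-- Averaging a Laurent series over the roots of unity keeps the exponents divisible by `n`. The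
parameter `r` moves the points to the circle of radius `r`, so the coefficient of $w^k$ is weighted
by $r^k$. -/
theorem hasSum_tilted_aliasing (n : ℕ) [NeZero n] (t r : ℝ) :
    HasSum (fun p : ℕ × ℕ => if (n : ℤ) ∣ (p.1 : ℤ) - p.2 then n * tiltedCoeff t r p else 0)
      (∑ k ∈ Finset.range n, (Complex.exp
        (t * r * Complex.exp (2 * Real.pi * Complex.I * (k / n)) +
          t * r⁻¹ * Complex.exp (-(2 * Real.pi * Complex.I * (k / n))))).re) := by
  have h := hasSum_sum fun (k : ℕ) (_ : k ∈ Finset.range n) =>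
    hasSum_tilted_exp t r (2 * Real.pi * Complex.I * (k / n))
  have h2 := Complex.hasSum_re h
  rw [Complex.re_sum] at h2
  refine h2.congr_fun fun p => ?_
  rw [← Finset.mul_sum, sum_pow_mul_conj_pow]
  split_ifs
  · rw [← Complex.ofReal_natCast, ← Complex.ofReal_mul, Complex.ofReal_re, mul_comm]
  · simp

theorem re_tilted (t r x : ℝ) :
    (t * r * Complex.exp (2 * Real.pi * Complex.I * x) +
      t * r⁻¹ * Complex.exp (-(2 * Real.pi * Complex.I * x))).re =
      t * (r + r⁻¹) * Real.cos (2 * Real.pi * x) := by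
  have h1 : (2 * Real.pi * Complex.I * x : ℂ) = ((2 * Real.pi * x : ℝ) : ℂ) * Complex.I := by
    push_cast; ring
  have h2 : (-(2 * Real.pi * Complex.I * x) : ℂ) = ((-(2 * Real.pi * x) : ℝ) : ℂ) * Complex.I := by
    push_cast; ring
  rw [h2, h1, ← Complex.ofReal_mul, ← Complex.ofReal_mul, Complex.add_re, Complex.re_ofReal_mul,
    Complex.re_ofReal_mul, Complex.exp_ofReal_mul_I_re, Complex.exp_ofReal_mul_I_re, Real.cos_neg]
  ring

theorem cycleTheta_nonneg (n : ℕ) (t : ℝ) : 0 ≤ cycleTheta n t :=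
  Finset.sum_nonneg fun _ _ => (Real.exp_pos _).le

theorem cycleTheta_antitone (n : ℕ) : Antitone (cycleTheta n) := by
  intro s t h
  refine Finset.sum_le_sum fun k _ => Real.exp_le_exp.2 ?_
  have := mul_le_mul_of_nonneg_right h (cycleEigenvalue_nonneg n k)
  linarith

theorem sum_exp_cos (n : ℕ) (t : ℝ) :
    ∑ k ∈ Finset.range n, Real.exp (2 * t * Real.cos (2 * Real.pi * ((k : ℝ) / n))) =
      Real.exp (2 * t) * cycleTheta n t := by
  rw [cycleTheta, Finset.mul_sum]
  refine Finset.sum_congr rfl fun k _ => ?_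
  rw [← Real.exp_add, cycleEigenvalue]
  ring_nf

theorem hasSum_cycleTheta (n : ℕ) [NeZero n] (t : ℝ) :
    HasSum (fun p : ℕ × ℕ => if (n : ℤ) ∣ (p.1 : ℤ) - p.2 then n * tiltedCoeff t 1 p else 0)
      (Real.exp (2 * t) * cycleTheta n t) := by
  have h := hasSum_tilted_aliasing n t 1
  rw [← sum_exp_cos]
  convert h using 2 with k
  have h3 : (t * (1 : ℝ) * Complex.exp (2 * Real.pi * Complex.I * (k / n)) +
      t * ((1 : ℝ)⁻¹ : ℝ) * Complex.exp (-(2 * Real.pi * Complex.I * (k / n))) : ℂ) =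
      ((2 * t * Real.cos (2 * Real.pi * ((k : ℝ) / n)) : ℝ) : ℂ) := by
    push_cast
    rw [Complex.cos]
    ring_nf
  rw [h3, ← Complex.ofReal_exp, Complex.ofReal_re]

/-- The tilted aliasing sums are dominated by the theta function of the cycle. -/
theorem tilted_sum_le (n : ℕ) {t r : ℝ} (ht : 0 ≤ t) (hr : 0 < r) :
    ∑ k ∈ Finset.range n, (Complex.exp
        (t * r * Complex.exp (2 * Real.pi * Complex.I * (k / n)) +
          t * r⁻¹ * Complex.exp (-(2 * Real.pi * Complex.I * (k / n))))).re ≤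
      Real.exp (t * (r + r⁻¹)) * cycleTheta n t := by
  have hc : 2 ≤ r + r⁻¹ := by
    have h : r + r⁻¹ - 2 = (r - 1) ^ 2 * r⁻¹ := by field_simp; ring
    have : 0 ≤ (r - 1) ^ 2 * r⁻¹ := by positivity
    linarith
  calc _ ≤ ∑ k ∈ Finset.range n,
        Real.exp (2 * (t * (r + r⁻¹) / 2) * Real.cos (2 * Real.pi * ((k : ℝ) / n))) := by
        -- Since $|e^w|=e^{\mathrm{Re}\,w}$, each summand becomes that of the untilted sum at the
        -- later time $t(r+r^{-1})/2\ge t$; monotonicity of the theta function then returns to time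
        -- $t$.
        refine Finset.sum_le_sum fun k _ => (Complex.re_le_norm _).trans (le_of_eq ?_)
        have h := re_tilted t r (k / n)
        rw [Complex.ofReal_div, Complex.ofReal_natCast, Complex.ofReal_natCast] at h
        rw [Complex.norm_exp, h]
        ring_nf
    _ = Real.exp (t * (r + r⁻¹)) * cycleTheta n (t * (r + r⁻¹) / 2) := by
        rw [sum_exp_cos]; ring_nf
    _ ≤ _ := by
        refine mul_le_mul_of_nonneg_left (cycleTheta_antitone n ?_) (Real.exp_pos _).le
        nlinarith

theorem hasSum_besselI0 (t : ℝ) :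
    HasSum (fun k : ℕ => tiltedCoeff t 1 (k, k)) (besselI0 (2 * t)) := by
  have h : Summable fun k : ℕ => tiltedCoeff t 1 (k, k) := by
    have := (hasSum_tilted_exp t 1 0).summable
    simp only [Complex.exp_zero, neg_zero, one_pow, mul_one] at this
    exact (Complex.summable_ofReal.1 this).comp_injective (i := fun k : ℕ => (k, k)) fun a b h => (Prod.ext_iff.1 h).1
  have h2 : besselI0 (2 * t) = ∑' k : ℕ, tiltedCoeff t 1 (k, k) := by
    unfold besselI0 tiltedCoeff
    congr 1
    funext k
    field_simp
    ring
  rw [h2]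
  exact h.hasSum

theorem hasSum_besselI0_diagonal (n : ℕ) (t : ℝ) :
    HasSum (fun p : ℕ × ℕ => if p.1 = p.2 then n * tiltedCoeff t 1 p else 0)
      (n * besselI0 (2 * t)) := by
  have h := (hasSum_besselI0 t).mul_left (n : ℝ)
  have hinj : Function.Injective fun k : ℕ => (k, k) := fun a b h => (Prod.ext_iff.1 h).1
  rw [← hinj.hasSum_iff]
  · refine h.congr_fun fun k => ?_
    simp
  · rintro ⟨i, j⟩ hp
    have : i ≠ j := fun h => hp ⟨i, by simp [h]⟩
    simp [this]

/-- Tilting multiplies the coefficient at $(i,j)$ by $r^{i-j}$, which is at least $r^n$ here. -/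
theorem tiltedCoeff_one_le {t r : ℝ} (ht : 0 ≤ t) (hr : 1 ≤ r) {n : ℕ} {p : ℕ × ℕ}
    (h : p.2 + n ≤ p.1) : tiltedCoeff t 1 p ≤ (r ^ n)⁻¹ * tiltedCoeff t r p := by
  have hr0 : 0 < r := by linarith
  obtain ⟨m, hm⟩ := Nat.exists_eq_add_of_le h
  have h1 : tiltedCoeff t r p = r ^ (n + m) * tiltedCoeff t 1 p := by
    simp only [tiltedCoeff, hm, mul_pow, inv_pow, pow_add, inv_one, mul_one]
    field_simp
  rw [h1, pow_add]
  have h2 := tiltedCoeff_nonneg ht zero_le_one p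
  have h3 : 1 ≤ r ^ m := one_le_pow₀ hr
  have h4 : (r ^ n)⁻¹ * (r ^ n * r ^ m * tiltedCoeff t 1 p) = r ^ m * tiltedCoeff t 1 p := by
    field_simp
  rw [h4]
  nlinarith

theorem tiltedCoeff_swap (t r : ℝ) (p : ℕ × ℕ) : tiltedCoeff t r p.swap = tiltedCoeff t r⁻¹ p := by
  simp only [tiltedCoeff, Prod.fst_swap, Prod.snd_swap, inv_inv]
  ring

/-- The diagonal pairs are among those with $n\mid i-j$, they sum to the Bessel function, and all
terms are nonnegative. -/
theorem mul_latticeKernel_le_cycleTheta (n : ℕ) [NeZero n] {t : ℝ} (ht : 0 ≤ t) :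
    n * latticeKernel t ≤ cycleTheta n t := by
  have h : n * besselI0 (2 * t) ≤ Real.exp (2 * t) * cycleTheta n t := by
    refine hasSum_le (fun p => ?_) (hasSum_besselI0_diagonal n t) (hasSum_cycleTheta n t)
    have := tiltedCoeff_nonneg ht zero_le_one p
    by_cases h : p.1 = p.2
    · simp [h]
    · rw [if_neg h]
      split_ifs <;> positivity
  rw [latticeKernel, Real.exp_neg]
  calc _ = (Real.exp (2 * t))⁻¹ * (n * besselI0 (2 * t)) := by ring
    _ ≤ (Real.exp (2 * t))⁻¹ * (Real.exp (2 * t) * cycleTheta n t) :=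
        mul_le_mul_of_nonneg_left h (by positivity)
    _ = _ := by field_simp

/-- Only pairs with $n\mid i-j\neq0$ remain, so $|i-j|\ge n$. Tilting by `r` controls those with
$i>j$ and tilting by `r⁻¹` those with $i<j$; hence the factor 2. -/
theorem cycleTheta_sub_le_tilted (n : ℕ) [NeZero n] {t r : ℝ} (ht : 0 ≤ t) (hr : 1 ≤ r) :
    cycleTheta n t - n * latticeKernel t ≤
      2 * (r ^ n)⁻¹ * Real.exp (t * (r + r⁻¹ - 2)) * cycleTheta n t := by
  have hr0 : 0 < r := by linarith
  have h1 := hasSum_tilted_aliasing n t r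
  have h2 := hasSum_tilted_aliasing n t r⁻¹
  have h3 : Real.exp (2 * t) * cycleTheta n t - n * besselI0 (2 * t) ≤
      (r ^ n)⁻¹ * (Real.exp (t * (r + r⁻¹)) * cycleTheta n t +
        Real.exp (t * (r⁻¹ + r⁻¹⁻¹)) * cycleTheta n t) := by
    refine (hasSum_le (fun p => ?_) ((hasSum_cycleTheta n t).sub (hasSum_besselI0_diagonal n t))
      ((h1.add h2).mul_left (r ^ n)⁻¹)).trans (mul_le_mul_of_nonneg_left
        (add_le_add (tilted_sum_le n ht hr0) (tilted_sum_le n ht (inv_pos.2 hr0))) (by positivity))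
    have ha := tiltedCoeff_nonneg ht hr0.le p
    have hb := tiltedCoeff_nonneg ht (inv_pos.2 hr0).le p
    by_cases hd : (n : ℤ) ∣ (p.1 : ℤ) - p.2
    · simp only [if_pos hd]
      have hn : (0 : ℝ) ≤ n := n.cast_nonneg
      have hrn : 0 ≤ (r ^ n)⁻¹ := by positivity
      have hna : 0 ≤ (r ^ n)⁻¹ * (n * tiltedCoeff t r p) := by positivity
      have hnb : 0 ≤ (r ^ n)⁻¹ * (n * tiltedCoeff t r⁻¹ p) := by positivity
      rcases lt_trichotomy p.1 p.2 with h | h | h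
      · rw [if_neg h.ne]
        have hle : p.1 + n ≤ p.2 := by
          have := Int.le_of_dvd (by omega) (dvd_neg.2 hd)
          omega
        have h5 := tiltedCoeff_one_le ht hr (p := p.swap) hle
        rw [tiltedCoeff_swap, tiltedCoeff_swap, inv_one] at h5
        have := mul_le_mul_of_nonneg_left h5 hn
        nlinarith
      · rw [if_pos h]
        nlinarith
      · rw [if_neg h.ne']
        have hle : p.2 + n ≤ p.1 := by
          have := Int.le_of_dvd (by omega) hd
          omega
        have h5 := tiltedCoeff_one_le ht hr hle
        have := mul_le_mul_of_nonneg_left h5 hn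
        nlinarith
    · have : p.1 ≠ p.2 := fun h => hd (by simp [h])
      simp [hd, this]
  rw [inv_inv, add_comm r⁻¹ r] at h3
  have h4 : Real.exp (t * (r + r⁻¹ - 2)) = Real.exp (t * (r + r⁻¹)) * (Real.exp (2 * t))⁻¹ := by
    rw [← Real.exp_neg, ← Real.exp_add]; ring_nf
  rw [latticeKernel, Real.exp_neg, h4]
  calc _ = (Real.exp (2 * t))⁻¹ *
        (Real.exp (2 * t) * cycleTheta n t - n * besselI0 (2 * t)) := by
        field_simp
    _ ≤ _ := mul_le_mul_of_nonneg_left h3 (by positivity)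
    _ = _ := by ring

/-- The theta function of a long cycle is close to the heat kernel of `ℤ`. -/
theorem cycleTheta_sub_le (n : ℕ) [NeZero n] {t : ℝ} (ht : 0 < t) :
    cycleTheta n t - n * latticeKernel t ≤
      2 * Real.exp 1 * ((1 + 1 / √t) ^ n)⁻¹ * cycleTheta n t := by
  have hs : 0 < √t := Real.sqrt_pos.2 ht
  have hr : 1 ≤ 1 + 1 / √t := by
    have : 0 < 1 / √t := by positivity
    linarith
  refine (cycleTheta_sub_le_tilted n ht.le hr).trans
    (mul_le_mul_of_nonneg_right ?_ (cycleTheta_nonneg n t))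
  -- The tilt $r=1+1/\sqrt t$ keeps the exponent $t(r-1)^2/r$ bounded, while $r^n$ is large once
  -- $n\gg\sqrt t$.
  have h : t * ((1 + 1 / √t) + (1 + 1 / √t)⁻¹ - 2) ≤ 1 := by
    have h2 : t * ((1 + 1 / √t) + (1 + 1 / √t)⁻¹ - 2) = √t / (√t + 1) := by
      nth_rewrite 1 [← Real.sq_sqrt ht.le]
      field_simp
      ring
    rw [h2, div_le_one (by positivity)]
    linarith
  rw [mul_right_comm 2 (Real.exp 1)]
  exact mul_le_mul_of_nonneg_left (Real.exp_le_exp.2 h) (by positivity)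

theorem exp_neg_le_latticeKernel {t : ℝ} (ht : 0 ≤ t) :
    Real.exp (-(2 * t)) ≤ latticeKernel t := by
  have h : 1 ≤ besselI0 (2 * t) := by
    have := (hasSum_besselI0 t).summable.le_tsum 0 fun k _ => tiltedCoeff_nonneg ht zero_le_one _
    rw [(hasSum_besselI0 t).tsum_eq] at this
    simpa [tiltedCoeff] using this
  exact le_mul_of_one_le_right (Real.exp_pos _).le h

theorem latticeKernel_pos {t : ℝ} (ht : 0 ≤ t) : 0 < latticeKernel t :=
  (Real.exp_pos _).trans_le (exp_neg_le_latticeKernel ht)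

theorem latticeKernel_le_one {t : ℝ} (ht : 0 ≤ t) : latticeKernel t ≤ 1 := by
  -- The cycle of length 1 has the single eigenvalue 0, so its theta function is 1.
  simpa [cycleTheta, cycleEigenvalue] using mul_latticeKernel_le_cycleTheta 1 ht

theorem measurable_besselI0 : Measurable besselI0 := by
  have h : ∀ x, HasSum (fun k : ℕ => (x / 2) ^ (2 * k) / (k.factorial : ℝ) ^ 2) (besselI0 x) := by
    intro x
    have h1 := hasSum_besselI0 (x / 2)
    rw [mul_div_cancel₀ x two_ne_zero] at h1
    refine h1.congr_fun fun k => ?_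
    simp only [tiltedCoeff]
    field_simp
    ring
  refine measurable_of_tendsto_metrizable
    (f := fun n x => ∑ k ∈ Finset.range n, (x / 2) ^ (2 * k) / (k.factorial : ℝ) ^ 2) ?_ ?_
  · intro n
    fun_prop
  · exact tendsto_pi_nhds.2 fun x => (h x).tendsto_sum_nat

theorem measurable_latticeKernel : Measurable latticeKernel := by
  have := measurable_besselI0
  unfold latticeKernel
  fun_prop

end Aliasing


/-! ### Symmetric frequencies and the limit of the cycle theta functions -/

section Integers

/-- The eigenvalue `2 - 2 cos (2πz/n)` of the Laplacian of the cycle, for an integer frequency. -/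
def cycleEigenvalueInt (n : ℕ) (z : ℤ) : ℝ := 2 - 2 * Real.cos (2 * Real.pi * (z / n))

theorem cycleEigenvalue_val (n : ℕ) [NeZero n] (k : ZMod n) :
    cycleEigenvalue n k.val = cycleEigenvalueInt n k.valMinAbs := by
  have h : (((k.val : ℤ) : ℤ) : ZMod n) = ((k.valMinAbs : ℤ) : ZMod n) := by simp
  rw [ZMod.intCast_eq_intCast_iff_dvd_sub] at h
  obtain ⟨c, hc⟩ := h
  have hn : (n : ℝ) ≠ 0 := NeZero.ne _
  have hc' : (k.valMinAbs : ℝ) = (k.val : ℝ) + n * c := by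
    have : (k.valMinAbs : ℤ) = (k.val : ℤ) + n * c := by linarith
    exact_mod_cast this
  rw [cycleEigenvalue, cycleEigenvalueInt, hc', ← Real.cos_add_int_mul_two_pi _ c]
  congr 3
  field_simp

/-- Representatives of least absolute value put the small eigenvalues near frequency 0. Extending by
zero to all of ℤ gives one index set for every `n`, as dominated convergence requires. -/
theorem hasSum_cycleTheta_int (n : ℕ) [NeZero n] (t : ℝ) :
    HasSum (fun z : ℤ => if z * 2 ∈ Ioc (-(n : ℤ)) n then
      Real.exp (-(t * cycleEigenvalueInt n z)) else 0) (cycleTheta n t) := by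
  classical
  have h : cycleTheta n t = ∑ z ∈ Finset.univ.image (ZMod.valMinAbs (n := n)),
      if z * 2 ∈ Ioc (-(n : ℤ)) n then Real.exp (-(t * cycleEigenvalueInt n z)) else 0 := by
    rw [Finset.sum_image ZMod.injective_valMinAbs.injOn, cycleTheta, ← sum_zmod_val]
    refine Finset.sum_congr rfl fun k _ => ?_
    rw [if_pos k.valMinAbs_mem_Ioc, cycleEigenvalue_val]
  rw [h]
  refine hasSum_sum_of_ne_finset_zero fun z hz => if_neg fun h => hz ?_
  exact Finset.mem_image.2 ⟨(z : ZMod n), Finset.mem_univ _, (ZMod.valMinAbs_spec _ _).2 ⟨rfl, h⟩⟩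

/-- The inequality $\cos x\le1-2x^2/\pi^2$, valid for $|x|\le\pi$; the range of `z` is exactly what
puts $2\pi z/n$ there. -/
theorem le_cycleEigenvalueInt (n : ℕ) [NeZero n] {z : ℤ} (hz : z * 2 ∈ Ioc (-(n : ℤ)) n) :
    16 / (n : ℝ) ^ 2 * (z : ℝ) ^ 2 ≤ cycleEigenvalueInt n z := by
  have hn : (0 : ℝ) < n := Nat.cast_pos.2 (NeZero.pos n)
  have h1 : |2 * Real.pi * ((z : ℝ) / n)| ≤ Real.pi := by
    have h2 : |(z : ℝ) * 2| ≤ n := by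
      rw [abs_le]
      exact ⟨by exact_mod_cast hz.1.le, by exact_mod_cast hz.2⟩
    have h3 : 2 * Real.pi * ((z : ℝ) / n) = Real.pi * ((z * 2) / n) := by ring
    rw [h3, abs_mul, abs_div, abs_of_pos Real.pi_pos, abs_of_pos hn]
    exact mul_le_of_le_one_right Real.pi_pos.le ((div_le_one hn).2 h2)
  have h4 := Real.cos_le_one_sub_mul_cos_sq h1
  have h5 : 2 / Real.pi ^ 2 * (2 * Real.pi * ((z : ℝ) / n)) ^ 2 =
      8 / (n : ℝ) ^ 2 * (z : ℝ) ^ 2 := by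
    field_simp
    ring
  rw [cycleEigenvalueInt]
  have h6 : 16 / (n : ℝ) ^ 2 * (z : ℝ) ^ 2 = 2 * (8 / (n : ℝ) ^ 2 * (z : ℝ) ^ 2) := by ring
  linarith

/-- The Gaussian sum over the integers. -/
def gaussSum (c : ℝ) : ℝ := ∑' z : ℤ, Real.exp (-(c * (z : ℝ) ^ 2))

/-- The sum of the inverse squares of the nonzero integers. -/
def invSqSum : ℝ := ∑' z : ℤ, 1 / (z : ℝ) ^ 2

theorem hasSum_invSq : HasSum (fun z : ℤ => 1 / (z : ℝ) ^ 2) invSqSum :=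
  (Real.summable_one_div_int_pow.2 one_lt_two).hasSum

theorem invSqSum_nonneg : 0 ≤ invSqSum := tsum_nonneg fun _ => by positivity

/-- From $e^{-x}\le1/x$. At `z = 0` the last term is `1 / 0 = 0`, so the indicator supplies the
value 1. The resulting bound on the Gaussian sum, linear in $1/c$, is enough later. -/
theorem exp_neg_mul_sq_le {c : ℝ} (hc : 0 < c) (z : ℤ) :
    Real.exp (-(c * (z : ℝ) ^ 2)) ≤ (if z = 0 then 1 else 0) + 1 / c * (1 / (z : ℝ) ^ 2) := by
  by_cases hz : z = 0
  · simp [hz]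
  · have hz' : 0 < (z : ℝ) ^ 2 := by positivity
    rw [if_neg hz, zero_add, Real.exp_neg, one_div_mul_one_div, one_div]
    refine inv_anti₀ (by positivity) ?_
    have := Real.add_one_le_exp (c * (z : ℝ) ^ 2)
    linarith

theorem hasSum_bound (c : ℝ) :
    HasSum (fun z : ℤ => (if z = 0 then (1 : ℝ) else 0) + 1 / c * (1 / (z : ℝ) ^ 2))
      (1 + 1 / c * invSqSum) :=
  (hasSum_ite_eq (0 : ℤ) (1 : ℝ)).add (hasSum_invSq.mul_left _)

theorem summable_gaussSum {c : ℝ} (hc : 0 < c) :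
    Summable fun z : ℤ => Real.exp (-(c * (z : ℝ) ^ 2)) :=
  (hasSum_bound c).summable.of_nonneg_of_le (fun _ => (Real.exp_pos _).le) (exp_neg_mul_sq_le hc)

theorem gaussSum_le {c : ℝ} (hc : 0 < c) : gaussSum c ≤ 1 + 1 / c * invSqSum :=
  hasSum_le (exp_neg_mul_sq_le hc) (summable_gaussSum hc).hasSum (hasSum_bound c)

theorem cycle_term_le (n : ℕ) [NeZero n] {c t : ℝ} (ht : 0 ≤ t) (hc : c ≤ t * (16 / (n : ℝ) ^ 2))
    (z : ℤ) : (if z * 2 ∈ Ioc (-(n : ℤ)) n then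
      Real.exp (-(t * cycleEigenvalueInt n z)) else 0) ≤ Real.exp (-(c * (z : ℝ) ^ 2)) := by
  split_ifs with h
  · refine Real.exp_le_exp.2 (neg_le_neg ?_)
    have h1 := mul_le_mul_of_nonneg_left (le_cycleEigenvalueInt n h) ht
    have h2 := mul_le_mul_of_nonneg_right hc (sq_nonneg (z : ℝ))
    linarith
  · exact (Real.exp_pos _).le

theorem cycleTheta_le_gaussSum (n : ℕ) [NeZero n] {c t : ℝ} (ht : 0 ≤ t) (hc0 : 0 < c)
    (hc : c ≤ t * (16 / (n : ℝ) ^ 2)) : cycleTheta n t ≤ gaussSum c :=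
  hasSum_le (cycle_term_le n ht hc) (hasSum_cycleTheta_int n t) (summable_gaussSum hc0).hasSum

/-- The theta function of the circle of length `a`. -/
def circleTheta (a t : ℝ) : ℝ := gaussSum ((2 * Real.pi / a) ^ 2 * t)

/-- The half-angle formula. Continuity of `sinc` at 0 then gives the limit of the rescaled
eigenvalue, including `z = 0`. -/
theorem cycleEigenvalueInt_eq_sinc (n : ℕ) (z : ℤ) :
    cycleEigenvalueInt n z =
      (2 * Real.pi * (z / n)) ^ 2 * Real.sinc (Real.pi * (z / n)) ^ 2 := by
  have h : Real.cos (2 * Real.pi * (z / n)) = 1 - 2 * Real.sin (Real.pi * (z / n)) ^ 2 := by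
    rw [mul_assoc, Real.cos_two_mul, Real.cos_sq']
    ring
  have h2 : Real.sin (Real.pi * (z / n)) =
      Real.pi * (z / n) * Real.sinc (Real.pi * (z / n)) := by
    by_cases hx : Real.pi * ((z : ℝ) / n) = 0
    · simp [hx]
    · rw [Real.sinc_of_ne_zero hx, mul_div_cancel₀ _ hx]
  rw [cycleEigenvalueInt, h, h2]
  ring

theorem tendsto_cycle_frequency {n : ℝ → ℕ} {a : ℝ} (ha : 0 < a)
    (hn : Tendsto (fun u : ℝ => (n u : ℝ) / u) atTop (𝓝 a)) :
    Tendsto (fun u => (n u : ℝ)) atTop atTop := by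
  refine (hn.pos_mul_atTop ha tendsto_id).congr' ?_
  filter_upwards [eventually_gt_atTop 0] with u hu
  simp only [id]
  field_simp

theorem tendsto_mul_cycleEigenvalueInt {n : ℝ → ℕ} {a : ℝ} (ha : 0 < a)
    (hn : Tendsto (fun u : ℝ => (n u : ℝ) / u) atTop (𝓝 a)) (z : ℤ) :
    Tendsto (fun u => u ^ 2 * cycleEigenvalueInt (n u) z) atTop
      (𝓝 ((2 * Real.pi / a) ^ 2 * (z : ℝ) ^ 2)) := by
  have h1 : Tendsto (fun u => Real.pi * ((z : ℝ) / n u)) atTop (𝓝 0) := by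
    simpa using ((tendsto_cycle_frequency ha hn).const_div_atTop (z : ℝ)).const_mul Real.pi
  have h2 := (Real.continuous_sinc.tendsto 0).comp h1
  rw [Real.sinc_zero] at h2
  have h3 := (((hn.inv₀ ha.ne').const_mul (2 * Real.pi * (z : ℝ))).pow 2).mul (h2.pow 2)
  have h4 : (2 * Real.pi * (z : ℝ) * a⁻¹) ^ 2 * 1 ^ 2 =
    (2 * Real.pi / a) ^ 2 * (z : ℝ) ^ 2 := by ring
  rw [h4] at h3
  refine h3.congr fun u => ?_
  simp only [Function.comp]
  rw [cycleEigenvalueInt_eq_sinc, inv_div]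
  ring

/-- Eventually $n\le2au$. This makes the Gaussian majorant of the rescaled theta functions
independent of `u`. -/
theorem eventually_gauss_exponent_le {n : ℝ → ℕ} {a : ℝ} (ha : 0 < a) (hpos : ∀ u, 0 < u → 0 < n u)
    (hn : Tendsto (fun u : ℝ => (n u : ℝ) / u) atTop (𝓝 a)) :
    ∀ᶠ u in atTop, ∀ t : ℝ, 0 < t → 4 / a ^ 2 * t ≤ u ^ 2 * t * (16 / (n u : ℝ) ^ 2) := by
  filter_upwards [eventually_gt_atTop 0, hn.eventually_lt_const (by linarith : a < 2 * a)]
    with u hu hnu t ht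
  have hp : (0 : ℝ) < n u := Nat.cast_pos.2 (hpos u hu)
  rw [div_lt_iff₀ hu] at hnu
  have h : (n u : ℝ) ^ 2 ≤ 4 * a ^ 2 * u ^ 2 := by nlinarith
  rw [div_mul_eq_mul_div, mul_div_assoc', div_le_div_iff₀ (by positivity) (by positivity)]
  nlinarith

/-- Dominated convergence over the frequencies; the cutoff is inactive at a fixed frequency once `n
u` is large. -/
theorem tendsto_cycleTheta {n : ℝ → ℕ} {a : ℝ} (ha : 0 < a) (hpos : ∀ u, 0 < u → 0 < n u)
    (hn : Tendsto (fun u : ℝ => (n u : ℝ) / u) atTop (𝓝 a)) {t : ℝ} (ht : 0 < t) :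
    Tendsto (fun u => cycleTheta (n u) (u ^ 2 * t)) atTop (𝓝 (circleTheta a t)) := by
  have hb : 0 < 4 / a ^ 2 * t := by positivity
  have h := tendsto_tsum_of_dominated_convergence (𝓕 := atTop)
    (f := fun (u : ℝ) (z : ℤ) => if z * 2 ∈ Ioc (-(n u : ℤ)) (n u) then
      Real.exp (-(u ^ 2 * t * cycleEigenvalueInt (n u) z)) else 0)
    (g := fun z => Real.exp (-((2 * Real.pi / a) ^ 2 * t * (z : ℝ) ^ 2)))
    (summable_gaussSum hb) (fun z => ?_) ?_
  · refine h.congr' ?_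
    filter_upwards [eventually_gt_atTop 0] with u hu
    have : NeZero (n u) := ⟨(hpos u hu).ne'⟩
    exact (hasSum_cycleTheta_int (n u) _).tsum_eq
  · have h1 := ((tendsto_mul_cycleEigenvalueInt ha hn z).const_mul t).neg.rexp
    have h2 : (2 * Real.pi / a) ^ 2 * t * (z : ℝ) ^ 2 =
      t * ((2 * Real.pi / a) ^ 2 * (z : ℝ) ^ 2) := by ring
    rw [h2]
    refine h1.congr' ?_
    filter_upwards [(tendsto_cycle_frequency ha hn).eventually_gt_atTop |(z : ℝ) * 2|] with u hu
    rw [abs_lt] at hu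
    rw [if_pos ⟨by exact_mod_cast hu.1, by exact_mod_cast hu.2.le⟩]
    ring_nf
  · filter_upwards [eventually_gt_atTop 0, eventually_gauss_exponent_le ha hpos hn] with u hu h z
    have : NeZero (n u) := ⟨(hpos u hu).ne'⟩
    have h1 := cycle_term_le (n u) (by positivity : 0 ≤ u ^ 2 * t) (h t ht) z
    refine le_trans (le_of_eq ?_) h1
    rw [Real.norm_eq_abs, abs_of_nonneg]
    split_ifs
    · exact (Real.exp_pos _).le
    · exact le_rfl

end Integers

/-! ### Poisson summation and the decay of the heat kernel of ℤ -/

section Laplace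

/-- Only the zero frequency survives; the summands with $K=1$ dominate. -/
theorem tendsto_gaussSum_sq : Tendsto (fun K : ℕ => gaussSum ((K : ℝ) ^ 2 / 4)) atTop (𝓝 1) := by
  have h := tendsto_tsum_of_dominated_convergence (𝓕 := atTop)
    (f := fun (K : ℕ) (z : ℤ) => Real.exp (-((K : ℝ) ^ 2 / 4 * (z : ℝ) ^ 2)))
    (g := fun z : ℤ => if z = 0 then (1 : ℝ) else 0)
    (summable_gaussSum (by norm_num : (0 : ℝ) < 1 / 4)) (fun z => ?_) ?_
  · rwa [tsum_ite_eq] at h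
  · by_cases hz : z = 0
    · simp [hz]
    · rw [if_neg hz]
      have hz' : 0 < (z : ℝ) ^ 2 := by positivity
      refine Real.tendsto_exp_neg_atTop_nhds_zero.comp ?_
      refine Tendsto.atTop_mul_const hz' (Tendsto.atTop_div_const (by norm_num) ?_)
      exact (tendsto_pow_atTop two_ne_zero).comp tendsto_natCast_atTop_atTop
  · filter_upwards [eventually_ge_atTop 1] with K hK z
    rw [Real.norm_eq_abs, Real.abs_exp]
    refine Real.exp_le_exp.2 (neg_le_neg (mul_le_mul_of_nonneg_right ?_ (sq_nonneg _)))
    have : (1 : ℝ) ≤ (K : ℝ) ^ 2 := one_le_pow₀ (by exact_mod_cast hK)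
    linarith

/-- Poisson summation. -/
theorem circleTheta_eq {a t : ℝ} (ha : 0 < a) (ht : 0 < t) :
    circleTheta a t = a / √(4 * Real.pi * t) * gaussSum (a ^ 2 / (4 * t)) := by
  have h := Real.tsum_exp_neg_mul_int_sq (a := 4 * Real.pi * t / a ^ 2) (by positivity)
  have h1 : circleTheta a t =
      ∑' z : ℤ, Real.exp (-Real.pi * (4 * Real.pi * t / a ^ 2) * (z : ℝ) ^ 2) := by
    unfold circleTheta gaussSum
    congr 1
    funext z
    ring_nf
  have h2 : gaussSum (a ^ 2 / (4 * t)) =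
      ∑' z : ℤ, Real.exp (-Real.pi / (4 * Real.pi * t / a ^ 2) * (z : ℝ) ^ 2) := by
    unfold gaussSum
    congr 1
    funext z
    congr 1
    field_simp
  rw [h1, h2, h, ← Real.sqrt_eq_rpow, Real.sqrt_div (by positivity), Real.sqrt_sq ha.le, one_div_div]

/-- Laplace asymptotics of the heat kernel of `ℤ`. -/
theorem tendsto_mul_latticeKernel :
    Tendsto (fun u => u * latticeKernel (u ^ 2)) atTop (𝓝 (1 / √(4 * Real.pi))) := by
  -- Compare ℤ with a cycle of length $K\lceil u\rceil$ at time $u^2$. For fixed `K` the limit in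
  -- `u` is known from the circle of length `K`, and Poisson summation makes its dependence on `K`
  -- explicit.
  have hK : ∀ K : ℕ, 0 < K →
      Tendsto (fun u : ℝ => u / ((K * ⌈u⌉₊ : ℕ) : ℝ) * cycleTheta (K * ⌈u⌉₊) (u ^ 2)) atTop
        (𝓝 (1 / √(4 * Real.pi) * gaussSum ((K : ℝ) ^ 2 / 4))) := by
    intro K hK
    have hK' : (0 : ℝ) < K := Nat.cast_pos.2 hK
    have hn : Tendsto (fun u : ℝ => ((K * ⌈u⌉₊ : ℕ) : ℝ) / u) atTop (𝓝 K) := by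
      have := (tendsto_nat_ceil_div_atTop (R := ℝ)).const_mul (K : ℝ)
      rw [mul_one] at this
      refine this.congr fun u => ?_
      push_cast
      ring
    have h1 := tendsto_cycleTheta hK' (fun u hu => Nat.mul_pos hK (Nat.ceil_pos.2 hu)) hn one_pos
    rw [circleTheta_eq hK' one_pos] at h1
    have h2 := (hn.inv₀ hK'.ne').mul h1
    simp only [mul_one, inv_div] at h2
    convert h2 using 2
    field_simp
  have hlow : ∀ K : ℕ, 0 < K → ∀ u : ℝ, 0 < u →
      (1 - 2 * Real.exp 1 * ((2 : ℝ) ^ K)⁻¹) *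
        (u / ((K * ⌈u⌉₊ : ℕ) : ℝ) * cycleTheta (K * ⌈u⌉₊) (u ^ 2)) ≤ u * latticeKernel (u ^ 2) ∧
      u * latticeKernel (u ^ 2) ≤
        u / ((K * ⌈u⌉₊ : ℕ) : ℝ) * cycleTheta (K * ⌈u⌉₊) (u ^ 2) := by
    intro K hK u hu
    have hn : 0 < K * ⌈u⌉₊ := Nat.mul_pos hK (Nat.ceil_pos.2 hu)
    have : NeZero (K * ⌈u⌉₊) := ⟨hn.ne'⟩
    have hn' : (0 : ℝ) < (K * ⌈u⌉₊ : ℕ) := Nat.cast_pos.2 hn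
    have h1 := mul_latticeKernel_le_cycleTheta (K * ⌈u⌉₊) (sq_nonneg u)
    have h2 := cycleTheta_sub_le (K * ⌈u⌉₊) (pow_pos hu 2)
    rw [Real.sqrt_sq hu.le] at h2
    -- By Bernoulli $(1+1/u)^{\lceil u\rceil}\ge2$, so the relative aliasing error is at most
    -- $2e\cdot2^{-K}$, uniformly in `u`.
    have h3 : (2 : ℝ) ^ K ≤ (1 + 1 / u) ^ (K * ⌈u⌉₊) := by
      rw [mul_comm, pow_mul]
      refine pow_le_pow_left₀ zero_le_two ?_ K
      have h4 := one_add_mul_le_pow (a := 1 / u)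
        (by have : 0 < 1 / u := by positivity
            linarith) ⌈u⌉₊
      have h5 : 1 ≤ (⌈u⌉₊ : ℝ) * (1 / u) := by
        rw [mul_one_div, one_le_div hu]
        exact Nat.le_ceil u
      linarith
    have h6 : ((1 + 1 / u) ^ (K * ⌈u⌉₊))⁻¹ ≤ ((2 : ℝ) ^ K)⁻¹ := inv_anti₀ (by positivity) h3
    have hθ := cycleTheta_nonneg (K * ⌈u⌉₊) (u ^ 2)
    have h7 : 2 * Real.exp 1 * ((1 + 1 / u) ^ (K * ⌈u⌉₊))⁻¹ * cycleTheta (K * ⌈u⌉₊) (u ^ 2) ≤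
        2 * Real.exp 1 * ((2 : ℝ) ^ K)⁻¹ * cycleTheta (K * ⌈u⌉₊) (u ^ 2) := by gcongr
    have h8 : u * latticeKernel (u ^ 2) = u / ((K * ⌈u⌉₊ : ℕ) : ℝ) *
        ((K * ⌈u⌉₊ : ℕ) * latticeKernel (u ^ 2)) := by field_simp
    rw [h8]
    have hq : 0 ≤ u / ((K * ⌈u⌉₊ : ℕ) : ℝ) := by positivity
    refine ⟨?_, mul_le_mul_of_nonneg_left h1 hq⟩
    rw [mul_left_comm]
    refine mul_le_mul_of_nonneg_left ?_ hq
    linarith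
  have hlim1 : Tendsto (fun K : ℕ => 1 / √(4 * Real.pi) * gaussSum ((K : ℝ) ^ 2 / 4)) atTop
      (𝓝 (1 / √(4 * Real.pi))) := by
    simpa using tendsto_gaussSum_sq.const_mul (1 / √(4 * Real.pi))
  have hlim2 : Tendsto (fun K : ℕ => (1 - 2 * Real.exp 1 * ((2 : ℝ) ^ K)⁻¹) *
      (1 / √(4 * Real.pi) * gaussSum ((K : ℝ) ^ 2 / 4))) atTop (𝓝 (1 / √(4 * Real.pi))) := by
    have h := (tendsto_inv_atTop_zero.comp
      (tendsto_pow_atTop_atTop_of_one_lt (one_lt_two (α := ℝ)))).const_mul (2 * Real.exp 1)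
    have h' := (h.const_sub 1).mul hlim1
    simpa using h'
  -- The limits are iterated: first fix `K` so that the bounding limit is on the right side of `c`,
  -- then let `u` grow.
  refine tendsto_order.2 ⟨fun c hc => ?_, fun c hc => ?_⟩
  · obtain ⟨K, hK1, hK2⟩ := ((hlim2.eventually_const_lt hc).and (eventually_gt_atTop 0)).exists
    filter_upwards [((hK K hK2).const_mul _).eventually_const_lt hK1, eventually_gt_atTop 0]
      with u hu hu0
    exact hu.trans_le (hlow K hK2 u hu0).1
  · obtain ⟨K, hK1, hK2⟩ := ((hlim1.eventually_lt_const hc).and (eventually_gt_atTop 0)).exists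
    filter_upwards [(hK K hK2).eventually_lt_const hK1, eventually_gt_atTop 0] with u hu hu0
    exact (hlow K hK2 u hu0).2.trans_lt hu

theorem tendsto_mul_latticeKernel_scaled {n : ℝ → ℕ} {a : ℝ}
    (hn : Tendsto (fun u : ℝ => (n u : ℝ) / u) atTop (𝓝 a)) {t : ℝ} (ht : 0 < t) :
    Tendsto (fun u => n u * latticeKernel (u ^ 2 * t)) atTop (𝓝 (a / √(4 * Real.pi * t))) := by
  have hs : 0 < √t := Real.sqrt_pos.2 ht
  have h1 : Tendsto (fun u : ℝ => u * √t) atTop atTop := tendsto_id.atTop_mul_const hs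
  have h2 := (hn.mul (tendsto_mul_latticeKernel.comp h1)).mul_const (√t)⁻¹
  rw [Real.sqrt_mul (by positivity)]
  have h3 : a * (1 / √(4 * Real.pi)) * (√t)⁻¹ = a / (√(4 * Real.pi) * √t) := by field_simp
  rw [h3] at h2
  refine h2.congr' ?_
  filter_upwards [eventually_gt_atTop 0] with u hu
  simp only [Function.comp]
  rw [mul_pow, Real.sq_sqrt ht.le]
  field_simp

end Laplace


/-! ### Frullani's integral and the exact formula for the determinant -/

section LogDet

/-- A measurable function between two decaying exponentials differs from `e^{-t}` by `O(t)` at `0`,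
so the difference is integrable against `dt/t`. -/
theorem integrableOn_sub_exp_div {g : ℝ → ℝ} {α β : ℝ} (hα : 0 < α) (hβ : 0 < β)
    (hg : AEStronglyMeasurable g (volume.restrict (Ioi 0)))
    (h1 : ∀ t, 0 < t → Real.exp (-(α * t)) ≤ g t) (h2 : ∀ t, 0 < t → g t ≤ Real.exp (-(β * t))) :
    IntegrableOn (fun t => (g t - Real.exp (-t)) / t) (Ioi 0) := by
  set c := min β 1 with hc
  have hc0 : 0 < c := lt_min hβ one_pos
  have hc1 : c ≤ 1 := min_le_right _ _
  -- One majorant for both ranges: for $t\le1$ the quotient is at most $2+\alpha$ and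
  -- $e^{c}e^{-ct}\ge1$; for $t\ge1$ both exponentials are at most $e^{-ct}$.
  refine Integrable.mono' (g := fun t => (2 + α) * Real.exp c * Real.exp (-c * t))
    ((exp_neg_integrableOn_Ioi 0 hc0).const_mul _) ?_ ?_
  · refine (hg.sub ?_).mul ?_
    · exact (Real.continuous_exp.comp continuous_neg).aestronglyMeasurable
    · exact measurable_inv.aestronglyMeasurable
  · refine (ae_restrict_iff' measurableSet_Ioi).2 (Eventually.of_forall fun t ht => ?_)
    have ht : 0 < t := ht
    rw [Real.norm_eq_abs, abs_div, abs_of_pos ht, div_le_iff₀ ht]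
    have ha := h1 t ht
    have hb := h2 t ht
    rcases le_total t 1 with h | h
    · have h3 := Real.add_one_le_exp (-(α * t))
      have h4 := Real.add_one_le_exp (-t)
      have h5 : Real.exp (-(β * t)) ≤ 1 := Real.exp_le_one_iff.2 (by nlinarith)
      have h6 : Real.exp (-t) ≤ 1 := Real.exp_le_one_iff.2 (by linarith)
      have h7 : 1 ≤ Real.exp c * Real.exp (-c * t) := by
        rw [← Real.exp_add]
        exact Real.one_le_exp (by nlinarith)
      have h8 : |g t - Real.exp (-t)| ≤ (2 + α) * t := by
        rw [abs_le]
        constructor <;> nlinarith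
      have h9 : 0 ≤ (2 + α) * t := by positivity
      calc _ ≤ (2 + α) * t := h8
        _ ≤ (2 + α) * t * (Real.exp c * Real.exp (-c * t)) := le_mul_of_one_le_right h9 h7
        _ = _ := by ring
    · have h3 : Real.exp (-(β * t)) ≤ Real.exp (-c * t) := by
        refine Real.exp_le_exp.2 ?_
        have : c ≤ β := min_le_left _ _
        nlinarith
      have h4 : Real.exp (-t) ≤ Real.exp (-c * t) := Real.exp_le_exp.2 (by nlinarith)
      have h5 := Real.exp_pos (-(α * t))
      have h6 := Real.exp_pos (-t)
      have h7 : |g t - Real.exp (-t)| ≤ 2 * Real.exp (-c * t) := by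
        rw [abs_le]
        constructor <;> linarith
      have h8 : 1 ≤ Real.exp c := Real.one_le_exp hc0.le
      have h9 : 2 ≤ (2 + α) * Real.exp c * t := by
        have : 2 + α ≤ (2 + α) * Real.exp c := le_mul_of_one_le_right (by linarith) h8
        nlinarith
      calc _ ≤ 2 * Real.exp (-c * t) := h7
        _ ≤ (2 + α) * Real.exp c * t * Real.exp (-c * t) :=
          mul_le_mul_of_nonneg_right h9 (Real.exp_pos _).le
        _ = _ := by ring

theorem integrableOn_exp_sub_exp_div {lam : ℝ} (h : 0 < lam) :
    IntegrableOn (fun t => (Real.exp (-(lam * t)) - Real.exp (-t)) / t) (Ioi 0) :=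
  integrableOn_sub_exp_div h h (by fun_prop) (fun _ _ => le_rfl) fun _ _ => le_rfl

theorem integral_exp_sub_exp_div {lam : ℝ} (h : 0 < lam) :
    ∫ t in Ioi (0 : ℝ), (Real.exp (-(lam * t)) - Real.exp (-t)) / t = -Real.log lam := by
  have hf : Continuous fun x : ℝ => Real.exp (-x) := by fun_prop
  have h1 : ∀ t : ℝ, (Real.exp (-(lam * t)) - Real.exp (-t)) / t =
      t⁻¹ • (Real.exp (-(lam * t)) - Real.exp (-(1 * t))) := fun t => by
    rw [one_mul, smul_eq_mul, div_eq_inv_mul]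
  have hint := integrableOn_exp_sub_exp_div h
  simp only [h1] at hint ⊢
  rw [Frullani.integral_Ioi_eq (f := fun x => Real.exp (-x)) (L := 1) (R := 0)
    (hf.locallyIntegrable.locallyIntegrableOn _) h one_pos ?_ Real.tendsto_exp_neg_atTop_nhds_zero
    hint]
  · simp [Real.log_inv]
  · have := hf.tendsto 0
    simp only [neg_zero, Real.exp_zero] at this
    exact this.mono_left nhdsWithin_le_nhds

theorem exp_mul_besselI0_pow (d : ℕ) (t : ℝ) :
    Real.exp (-(2 * d * t)) * besselI0 (2 * t) ^ d = latticeKernel t ^ d := by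
  rw [latticeKernel, mul_pow, ← Real.exp_nat_mul]
  ring_nf

theorem integrableOn_bulkIntegrand (d : ℕ) {mu : ℝ} (hmu : 0 < mu) :
    IntegrableOn (bulkIntegrand d mu) (Ioi 0) := by
  have hm := measurable_latticeKernel
  refine (integrableOn_sub_exp_div (g := fun t => Real.exp (-(mu ^ 2 * t)) * latticeKernel t ^ d)
    (α := mu ^ 2 + 2 * d) (β := mu ^ 2) (by positivity) (by positivity) ?_ (fun t ht => ?_)
    fun t ht => ?_).congr_fun (fun t _ => ?_) measurableSet_Ioi
  · exact Measurable.aestronglyMeasurable (by fun_prop)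
  · have h := pow_le_pow_left₀ (Real.exp_pos _).le (exp_neg_le_latticeKernel ht.le) d
    rw [← Real.exp_nat_mul] at h
    calc _ = Real.exp (-(mu ^ 2 * t)) * Real.exp (d * -(2 * t)) := by
          rw [← Real.exp_add]; ring_nf
      _ ≤ _ := mul_le_mul_of_nonneg_left h (Real.exp_pos _).le
  · exact mul_le_of_le_one_right (Real.exp_pos _).le
      (pow_le_one₀ (latticeKernel_pos ht.le).le (latticeKernel_le_one ht.le))
  · simp only [bulkIntegrand]
    rw [mul_assoc, exp_mul_besselI0_pow]

variable {d : ℕ} (N : Fin d → ℕ) [∀ j, NeZero (N j)]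

/-- There are $\prod N_j$ eigenvalues, so subtracting $e^{-t}$ once for each matches the
regularizing term of the bulk integrand. Each piece is then separately integrable against $dt/t$. -/
theorem remainderIntegrand_eq_sum (mu t : ℝ) :
    remainderIntegrand N mu t =
      (∑ k : DiscreteTorus N,
        (Real.exp (-(discreteEigenvalue N mu k * t)) - Real.exp (-t)) / t) -
        (∏ j, (N j : ℝ)) * bulkIntegrand d mu t := by
  have hcard : (Fintype.card (DiscreteTorus N) : ℝ) = ∏ j, (N j : ℝ) := by
    rw [Fintype.card_pi]
    push_cast
    exact Finset.prod_congr rfl fun j _ => by rw [ZMod.card]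
  rw [remainderIntegrand, bulkIntegrand, theta_discreteLaplacian, ← Finset.sum_div,
    Finset.sum_sub_distrib, Finset.sum_const, Finset.card_univ, nsmul_eq_mul, hcard]
  ring

theorem integrableOn_sum_exp_sub_exp {mu : ℝ} (hmu : 0 < mu) :
    IntegrableOn (fun t => ∑ k : DiscreteTorus N,
      (Real.exp (-(discreteEigenvalue N mu k * t)) - Real.exp (-t)) / t) (Ioi 0) :=
  integrable_finsetSum _ fun k _ => integrableOn_exp_sub_exp_div (discreteEigenvalue_pos N hmu k)

theorem integrableOn_remainderIntegrand {mu : ℝ} (hmu : 0 < mu) :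
    IntegrableOn (remainderIntegrand N mu) (Ioi 0) :=
  ((integrableOn_sum_exp_sub_exp N hmu).sub
    ((integrableOn_bulkIntegrand d hmu).const_mul _)).congr_fun
    (fun t _ => (remainderIntegrand_eq_sum N mu t).symm) measurableSet_Ioi

theorem bulk_add_remainder {mu : ℝ} (hmu : 0 < mu) :
    (∏ j, (N j : ℝ)) * bulk d mu + remainder N mu =
      ∑ k : DiscreteTorus N, Real.log (discreteEigenvalue N mu k) := by
  rw [bulk, remainder]
  simp only [remainderIntegrand_eq_sum]
  rw [integral_sub (integrableOn_sum_exp_sub_exp N hmu)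
    ((integrableOn_bulkIntegrand d hmu).const_mul _), integral_const_mul, integral_finsetSum _
    fun k _ => integrableOn_exp_sub_exp_div (discreteEigenvalue_pos N hmu k)]
  simp only [integral_exp_sub_exp_div (discreteEigenvalue_pos N hmu _), Finset.sum_neg_distrib]
  ring

theorem det_discreteLaplacian_ne_zero {mu : ℝ} (hmu : 0 < mu) :
    LinearMap.det (discreteLaplacian N mu) ≠ 0 := by
  rw [det_discreteLaplacian]
  exact Complex.ofReal_ne_zero.2
    (Finset.prod_pos fun k _ => discreteEigenvalue_pos N hmu k).ne'

theorem log_det_discreteLaplacian {mu : ℝ} (hmu : 0 < mu) :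
    Complex.log (LinearMap.det (discreteLaplacian N mu)) =
      (((∏ j, (N j : ℝ)) * bulk d mu + remainder N mu : ℝ) : ℂ) := by
  rw [det_discreteLaplacian, ← Complex.ofReal_log
    (Finset.prod_pos fun k _ => discreteEigenvalue_pos N hmu k).le, bulk_add_remainder N hmu,
    Real.log_prod fun k _ => (discreteEigenvalue_pos N hmu k).ne']

end LogDet

/-! ### Uniform bounds on the defect of the discrete tori -/

section Defect

/-- Telescoping one factor at a time: relative errors add up under products. -/
theorem prod_sub_prod_le {ι : Type*} (s : Finset ι) (x y δ : ι → ℝ)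
    (hy : ∀ j ∈ s, 0 ≤ y j) (hyx : ∀ j ∈ s, y j ≤ x j) (h : ∀ j ∈ s, x j - y j ≤ δ j * x j) :
    ∏ j ∈ s, x j - ∏ j ∈ s, y j ≤ (∑ j ∈ s, δ j) * ∏ j ∈ s, x j := by
  classical
  induction s using Finset.induction_on with
  | empty => simp
  | insert i s hi ih =>
    rw [Finset.prod_insert hi, Finset.prod_insert hi, Finset.sum_insert hi]
    have ih' := ih (fun j hj => hy j (Finset.mem_insert_of_mem hj))
      (fun j hj => hyx j (Finset.mem_insert_of_mem hj))
      fun j hj => h j (Finset.mem_insert_of_mem hj)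
    have h0 := hy i (Finset.mem_insert_self i s)
    have h1 := hyx i (Finset.mem_insert_self i s)
    have h2 := h i (Finset.mem_insert_self i s)
    have hP : 0 ≤ ∏ j ∈ s, x j := Finset.prod_nonneg fun j hj =>
      (hy j (Finset.mem_insert_of_mem hj)).trans (hyx j (Finset.mem_insert_of_mem hj))
    have hPQ : ∏ j ∈ s, y j ≤ ∏ j ∈ s, x j := Finset.prod_le_prod
      (fun j hj => hy j (Finset.mem_insert_of_mem hj))
      fun j hj => hyx j (Finset.mem_insert_of_mem hj)
    calc x i * ∏ j ∈ s, x j - y i * ∏ j ∈ s, y j =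
        (x i - y i) * ∏ j ∈ s, x j + y i * (∏ j ∈ s, x j - ∏ j ∈ s, y j) := by ring
      _ ≤ δ i * x i * ∏ j ∈ s, x j + x i * ((∑ j ∈ s, δ j) * ∏ j ∈ s, x j) :=
        add_le_add (mul_le_mul_of_nonneg_right h2 hP)
          (mul_le_mul h1 ih' (sub_nonneg.2 hPQ) (h0.trans h1))
      _ = _ := by ring

variable {d : ℕ}

/-- The difference between the massless theta function of the discrete torus and its bulk part. -/
def discreteDefect (N : Fin d → ℕ) (t : ℝ) : ℝ :=
  ∏ j, cycleTheta (N j) t - ∏ j, (N j : ℝ) * latticeKernel t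

theorem remainderIntegrand_eq_defect (N : Fin d → ℕ) [∀ j, NeZero (N j)] (mu t : ℝ) :
    remainderIntegrand N mu t = Real.exp (-(mu ^ 2 * t)) * discreteDefect N t / t := by
  rw [remainderIntegrand, theta_discreteLaplacian, sum_exp_discreteEigenvalue, mul_assoc (Real.exp _)
    (Real.exp _), exp_mul_besselI0_pow, discreteDefect, Finset.prod_mul_distrib, Finset.prod_const,
    Finset.card_univ, Fintype.card_fin]
  ring

theorem discreteDefect_nonneg (N : Fin d → ℕ) [∀ j, NeZero (N j)] {t : ℝ} (ht : 0 ≤ t) :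
    0 ≤ discreteDefect N t :=
  sub_nonneg.2 (Finset.prod_le_prod
    (fun _ _ => mul_nonneg (Nat.cast_nonneg _) (latticeKernel_pos ht).le)
    fun j _ => mul_latticeKernel_le_cycleTheta (N j) ht)

/-- A power of the aliasing factor. -/
theorem inv_one_add_pow_le {q n : ℕ} (hq : 0 < q) (hn : 2 * q ≤ n) {s : ℝ} (hs : 0 < s) :
    ((1 + 1 / s) ^ n)⁻¹ ≤ (4 * q * s / n) ^ (2 * q) := by
  have hq2 : 0 < 2 * q := by omega
  have hn0 : 0 < n := by omega
  have hk : 0 < n / (2 * q) := Nat.div_pos hn hq2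
  have hn' : (0 : ℝ) < n := Nat.cast_pos.2 hn0
  have hq' : (0 : ℝ) < q := Nat.cast_pos.2 hq
  -- Bernoulli is applied to the exponent `n / (2 * q)`; since `2 * q ≤ n`, rounding down loses at
  -- most a factor 2.
  have h1 : (n : ℝ) ≤ 4 * q * (n / (2 * q) : ℕ) := by
    have h2 : n < 2 * q * (n / (2 * q) + 1) := by
      rw [mul_comm]
      exact Nat.lt_mul_of_div_lt (Nat.lt_succ_self _) hq2
    have h3 : n ≤ 4 * q * (n / (2 * q)) := by nlinarith
    exact_mod_cast h3
  have h4 : n / (4 * q * s) ≤ (1 + 1 / s) ^ (n / (2 * q)) := by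
    have h5 := one_add_mul_le_pow (a := 1 / s)
      (by have : 0 < 1 / s := by positivity
          linarith) (n / (2 * q))
    have h6 : n / (4 * q * s) ≤ (n / (2 * q) : ℕ) * (1 / s) := by
      rw [mul_one_div, div_le_div_iff₀ (by positivity) hs]
      nlinarith
    linarith
  have h7 : (n / (4 * q * s)) ^ (2 * q) ≤ (1 + 1 / s) ^ n := by
    refine (pow_le_pow_left₀ (by positivity) h4 (2 * q)).trans ?_
    rw [← pow_mul]
    refine pow_le_pow_right₀ ?_ (Nat.div_mul_le_self n (2 * q))
    have : 0 < 1 / s := by positivity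
    linarith
  calc _ ≤ ((n / (4 * q * s)) ^ (2 * q))⁻¹ := inv_anti₀ (by positivity) h7
    _ = _ := by rw [← inv_pow, inv_div]

/-- Uniform smallness of the defect of the rescaled discrete tori. -/
theorem eventually_discreteDefect_le {a : Fin d → ℝ} (ha : ∀ j, 0 < a j) {N : ℝ → Fin d → ℕ}
    (hN : ∀ u, 0 < u → ∀ j, 0 < N u j)
    (hNa : ∀ j, Tendsto (fun u : ℝ => (N u j : ℝ) / u) atTop (𝓝 (a j))) (Q : ℕ) :
    ∃ C, 0 ≤ C ∧ ∀ᶠ u in atTop, ∀ t, 0 < t →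
      discreteDefect (N u) (u ^ 2 * t) ≤ C * t ^ (Q + 1) * (1 + t) ^ d := by
  -- The aliasing factor supplies $t^q$, and the product of theta functions costs $((1+t)/t)^d$;
  -- this leaves $t^{Q+1}(1+t)^d$.
  set q := d + Q + 1 with hq
  have hS := invSqSum_nonneg
  set B : Fin d → ℝ := fun j => 1 + a j ^ 2 / 4 * invSqSum with hB
  have hB0 : ∀ j, 0 ≤ B j := fun j => by have := ha j; positivity
  set A : ℝ := ∑ j, 2 * Real.exp 1 * (8 * q / a j) ^ (2 * q) with hA
  have hA0 : 0 ≤ A := Finset.sum_nonneg fun j _ => by have := ha j; positivity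
  refine ⟨A * ∏ j, B j, mul_nonneg hA0 (Finset.prod_nonneg fun j _ => hB0 j), ?_⟩
  have hev : ∀ j, ∀ᶠ u in atTop, (2 * q ≤ N u j ∧ a j / 2 * u ≤ N u j) ∧
      ∀ t : ℝ, 0 < t → 4 / a j ^ 2 * t ≤ u ^ 2 * t * (16 / (N u j : ℝ) ^ 2) := by
    intro j
    filter_upwards [(tendsto_cycle_frequency (ha j) (hNa j)).eventually_ge_atTop ((2 * q : ℕ) : ℝ),
      (hNa j).eventually_const_lt (half_lt_self (ha j)), eventually_gt_atTop 0,
      eventually_gauss_exponent_le (ha j) (fun u hu => hN u hu j) (hNa j)] with u h1 h2 h3 h4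
    exact ⟨⟨by exact_mod_cast h1, ((lt_div_iff₀ h3).1 h2).le⟩, h4⟩
  filter_upwards [eventually_gt_atTop 0, eventually_all.2 hev] with u hu h t ht
  have : ∀ j, NeZero (N u j) := fun j => ⟨(hN u hu j).ne'⟩
  have hτ : 0 < u ^ 2 * t := by positivity
  have h1 := prod_sub_prod_le Finset.univ (fun j => cycleTheta (N u j) (u ^ 2 * t))
    (fun j => (N u j : ℝ) * latticeKernel (u ^ 2 * t))
    (fun j => 2 * Real.exp 1 * (8 * q / a j) ^ (2 * q) * t ^ q)
    (fun j _ => mul_nonneg (Nat.cast_nonneg _) (latticeKernel_pos hτ.le).le)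
    (fun j _ => mul_latticeKernel_le_cycleTheta (N u j) hτ.le) fun j _ => ?_
  · refine h1.trans ?_
    rw [← Finset.sum_mul]
    have h2 : ∏ j, cycleTheta (N u j) (u ^ 2 * t) ≤ ∏ j, (B j * ((1 + t) / t)) := by
      refine Finset.prod_le_prod (fun j _ => cycleTheta_nonneg _ _) fun j _ => ?_
      have haj := ha j
      have hc : 0 < 4 / a j ^ 2 * t := by positivity
      refine ((cycleTheta_le_gaussSum (N u j) hτ.le hc ((h j).2 t ht)).trans
        (gaussSum_le hc)).trans ?_
      simp only [hB]
      have h3 : 1 + 1 / (4 / a j ^ 2 * t) * invSqSum = 1 + a j ^ 2 / 4 * invSqSum / t := by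
        field_simp
      rw [h3, mul_div_assoc', le_div_iff₀ ht, add_mul, div_mul_cancel₀ _ ht.ne']
      have h4 : 0 ≤ a j ^ 2 / 4 * invSqSum := by positivity
      nlinarith
    rw [Finset.prod_mul_distrib, Finset.prod_const, Finset.card_univ, Fintype.card_fin] at h2
    calc _ ≤ A * t ^ q * ((∏ j, B j) * ((1 + t) / t) ^ d) :=
          mul_le_mul_of_nonneg_left h2 (by positivity)
      _ = _ := by
          rw [hq, div_pow, add_assoc, pow_add]
          field_simp
  · refine (cycleTheta_sub_le (N u j) hτ).trans
      (mul_le_mul_of_nonneg_right ?_ (cycleTheta_nonneg _ _))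
    rw [mul_assoc (2 * Real.exp 1)]
    refine mul_le_mul_of_nonneg_left ?_ (by positivity)
    refine (inv_one_add_pow_le (q := q) (by omega) (h j).1.1 (Real.sqrt_pos.2 hτ)).trans ?_
    have haj := ha j
    have hNj : (0 : ℝ) < N u j := Nat.cast_pos.2 (hN u hu j)
    -- From $N_j\ge a_ju/2$: the scale `u` cancels, which makes the bound uniform.
    have h2 : 4 * q * √(u ^ 2 * t) / N u j ≤ 8 * q / a j * √t := by
      rw [Real.sqrt_mul (by positivity), Real.sqrt_sq hu.le, div_le_iff₀ hNj]
      have h3 := (h j).1.2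
      have h4 : 4 * q * (u * √t) = 8 * q / a j * √t * (a j / 2 * u) := by
        field_simp
        ring
      rw [h4]
      exact mul_le_mul_of_nonneg_left h3 (by positivity)
    refine (pow_le_pow_left₀ (by positivity) h2 _).trans (le_of_eq ?_)
    rw [mul_pow, pow_mul (√t), Real.sq_sqrt ht.le]

end Defect


/-! ### Smooth functions on the torus and their Fourier coefficients -/

section TorusFunctions

variable {d : ℕ}

/-- The `j`-th partial derivative. -/
def partialDeriv (j : Fin d) (f : EuclideanSpace ℝ (Fin d) → ℂ) :
    EuclideanSpace ℝ (Fin d) → ℂ :=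
  fun x => fderiv ℝ f x (EuclideanSpace.single j 1)

theorem partialDeriv_mem {a : Fin d → ℝ} {f : EuclideanSpace ℝ (Fin d) → ℂ}
    (hf : f ∈ smoothTorusFunctions a) (j : Fin d) : partialDeriv j f ∈ smoothTorusFunctions a := by
  obtain ⟨hf, hp⟩ := hf
  refine ⟨(hf.fderiv_right (m := ∞) le_rfl).clm_apply contDiff_const, fun i x => ?_⟩
  have h : (fun y => f (y + EuclideanSpace.single i (a i))) = f := funext fun y => hp i y
  have h2 := fderiv_comp_add_right (𝕜 := ℝ) (f := f) (x := x) (EuclideanSpace.single i (a i))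
  rw [h] at h2
  simp only [partialDeriv, h2]

theorem laplacian_eq_sum_partialDeriv {f : EuclideanSpace ℝ (Fin d) → ℂ} (hf : ContDiff ℝ ∞ f)
    (x : EuclideanSpace ℝ (Fin d)) :
    Laplacian.laplacian f x = ∑ j, partialDeriv j (partialDeriv j f) x := by
  rw [InnerProductSpace.laplacian_eq_iteratedFDeriv_orthonormalBasis f
    (EuclideanSpace.basisFun (Fin d) ℝ)]
  refine Finset.sum_congr rfl fun j _ => ?_
  have h : DifferentiableAt ℝ (fderiv ℝ f) x :=
    ((hf.fderiv_right (m := ∞) le_rfl).differentiable (by simp)).differentiableAt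
  rw [iteratedFDeriv_two_apply]
  unfold partialDeriv
  rw [fderiv_clm_apply h (differentiableAt_const _)]
  simp

/-- The point of `ℝ^d` with coordinates `a_j y_j`. -/
def scalePoint (a y : Fin d → ℝ) : EuclideanSpace ℝ (Fin d) := WithLp.toLp 2 fun j => a j * y j

theorem continuous_scalePoint (a : Fin d → ℝ) : Continuous (scalePoint a) := by
  unfold scalePoint
  exact (PiLp.continuous_toLp 2 _).comp (by fun_prop)

theorem scalePoint_add_single (a y : Fin d → ℝ) (j : Fin d) (s : ℝ) :
    scalePoint a (y + Pi.single j s) =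
      scalePoint a y + s • a j • EuclideanSpace.single j (1 : ℝ) := by
  ext i
  simp only [scalePoint, Pi.add_apply, PiLp.add_apply, PiLp.smul_apply, PiLp.single_apply,
    smul_eq_mul]
  by_cases h : i = j
  · subst h
    simp
    ring
  · simp [h]

theorem smoothTorusFunctions_periodic {a : Fin d → ℝ} {f : EuclideanSpace ℝ (Fin d) → ℂ}
    (hf : f ∈ smoothTorusFunctions a) (y : Fin d → ℝ) (k : Fin d → ℤ) :
    f (scalePoint a fun j => y j + k j) = f (scalePoint a y) := by
  have h : ∀ s : Finset (Fin d), ∀ x,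
      f (x + ∑ j ∈ s, k j • EuclideanSpace.single j (a j)) = f x := by
    intro s
    induction s using Finset.induction_on with
    | empty => simp
    | insert i s hi ih =>
      intro x
      have hp : Function.Periodic f (EuclideanSpace.single i (a i)) := fun x => hf.2 i x
      rw [Finset.sum_insert hi, ← add_assoc, ih, hp.zsmul (k i) x]
  rw [← h Finset.univ (scalePoint a y)]
  congr 1
  ext i
  simp only [scalePoint, PiLp.add_apply, WithLp.ofLp_sum, ← Int.cast_smul_eq_zsmul ℝ,
    WithLp.ofLp_smul, Finset.sum_apply, Pi.smul_apply, PiLp.ofLp_single]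
  rw [Finset.sum_eq_single i]
  · simp
    ring
  · intro b _ hb
    simp [Ne.symm hb]
  · simp

/-- The projection of `ℝ^d` to the unit torus. -/
def torusProj (d : ℕ) : C(Fin d → ℝ, UnitAddTorus (Fin d)) where
  toFun y := fun j => (y j : UnitAddCircle)
  continuous_toFun := continuous_pi fun j =>
    (AddCircle.continuous_mk' 1).comp (continuous_apply j)

theorem torusProj_isQuotientMap (d : ℕ) : IsQuotientMap (torusProj d) :=
  (IsOpenQuotientMap.piMap fun _ : Fin d => QuotientAddGroup.isOpenQuotientMap_mk
    (N := AddSubgroup.zmultiples (1 : ℝ))).isQuotientMap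

theorem torusProj_surjective (d : ℕ) : Function.Surjective (torusProj d) :=
  (torusProj_isQuotientMap d).surjective

theorem torusProj_eq {y y' : Fin d → ℝ} (h : torusProj d y = torusProj d y') :
    ∃ k : Fin d → ℤ, y' = fun j => y j + k j := by
  have h1 : ∀ j, ∃ k : ℤ, k • (1 : ℝ) = y' j - y j := fun j => by
    rw [← AddCircle.coe_eq_zero_iff, AddCircle.coe_sub, sub_eq_zero]
    exact (congrFun h j).symm
  choose k hk using h1
  refine ⟨k, funext fun j => ?_⟩
  have := hk j
  simp only [zsmul_eq_mul, mul_one] at this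
  linarith

/-- A function on the torus, in coordinates with period `1`. -/
def unitPeriodic {a : Fin d → ℝ} (f : smoothTorusFunctions a) : C(Fin d → ℝ, ℂ) where
  toFun y := (f : EuclideanSpace ℝ (Fin d) → ℂ) (scalePoint a y)
  continuous_toFun := f.2.1.continuous.comp (continuous_scalePoint a)

theorem unitPeriodic_factorsThrough {a : Fin d → ℝ} (f : smoothTorusFunctions a) :
    Function.FactorsThrough (unitPeriodic f) (torusProj d) := fun y y' h => by
  obtain ⟨k, rfl⟩ := torusProj_eq h
  exact (smoothTorusFunctions_periodic f.2 y k).symm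

/-- A function on the torus, as a function on the unit torus. -/
def unitLift {a : Fin d → ℝ} (f : smoothTorusFunctions a) : C(UnitAddTorus (Fin d), ℂ) :=
  (torusProj_isQuotientMap d).lift (unitPeriodic f) (unitPeriodic_factorsThrough f)

theorem unitLift_apply {a : Fin d → ℝ} (f : smoothTorusFunctions a) (y : Fin d → ℝ) :
    unitLift f (torusProj d y) = (f : EuclideanSpace ℝ (Fin d) → ℂ) (scalePoint a y) :=
  DFunLike.congr_fun (IsQuotientMap.lift_comp (torusProj_isQuotientMap d) (unitPeriodic f)
    (unitPeriodic_factorsThrough f)) y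

/-- The partial derivative of a function on the torus. -/
def torusPartial {a : Fin d → ℝ} (j : Fin d) (f : smoothTorusFunctions a) :
    smoothTorusFunctions a :=
  ⟨partialDeriv j f, partialDeriv_mem f.2 j⟩

/-- The Haar probability measure on the unit torus. -/
def torusMeasure (d : ℕ) : Measure (UnitAddTorus (Fin d)) :=
  Measure.pi fun _ : Fin d => (AddCircle.haarAddCircle : Measure UnitAddCircle)

instance (d : ℕ) : (torusMeasure d).IsAddHaarMeasure :=
  inferInstanceAs (Measure.pi _).IsAddHaarMeasure

instance (d : ℕ) : IsProbabilityMeasure (torusMeasure d) :=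
  inferInstanceAs (IsProbabilityMeasure (Measure.pi _))

/-- The Fourier coefficients of a function on the torus. -/
def torusCoeff {a : Fin d → ℝ} (f : smoothTorusFunctions a) (k : Fin d → ℤ) : ℂ :=
  UnitAddTorus.mFourierCoeff (unitLift f) k

theorem torusCoeff_eq {a : Fin d → ℝ} (f : smoothTorusFunctions a) (k : Fin d → ℤ) :
    torusCoeff f k = ∫ y, UnitAddTorus.mFourier (-k) y * unitLift f y ∂(torusMeasure d) := rfl

theorem mFourier_torusProj (k : Fin d → ℤ) (y : Fin d → ℝ) :
    UnitAddTorus.mFourier k (torusProj d y) =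
      Complex.exp (2 * Real.pi * Complex.I * ∑ j, (k j : ℂ) * y j) := by
  change ∏ j, fourier (k j) ((y j : ℝ) : UnitAddCircle) = _
  simp only [fourier_coe_apply]
  rw [← Complex.exp_sum, Finset.mul_sum]
  congr 1
  refine Finset.sum_congr rfl fun j _ => ?_
  push_cast
  ring

/-- Translation invariance of Haar measure moves the shift onto the character. Its derivative in `s`
replaces integration by parts. -/
theorem integral_mFourier_mul_translate (F : C(UnitAddTorus (Fin d), ℂ)) (k : Fin d → ℤ)
    (j : Fin d) (s : ℝ) :
    ∫ y, UnitAddTorus.mFourier (-k) y * F (y + torusProj d (Pi.single j s)) ∂(torusMeasure d) =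
      Complex.exp (2 * Real.pi * Complex.I * k j * s) *
        ∫ y, UnitAddTorus.mFourier (-k) y * F y ∂(torusMeasure d) := by
  rw [← integral_const_mul]
  conv_rhs => rw [← integral_add_right_eq_self _ (torusProj d (Pi.single j s))]
  congr 1
  funext y
  obtain ⟨z, rfl⟩ := torusProj_surjective d y
  have h : torusProj d z + torusProj d (Pi.single j s) = torusProj d (z + Pi.single j s) := rfl
  rw [h, mFourier_torusProj, mFourier_torusProj, ← mul_assoc, ← Complex.exp_add]
  congr 2
  have h2 : ∑ i, ((-k) i : ℂ) * ((z + Pi.single j s : Fin d → ℝ) i : ℝ) =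
      ∑ i, ((-k) i : ℂ) * (z i : ℝ) - k j * s := by
    simp only [Pi.add_apply, Complex.ofReal_add, mul_add, Finset.sum_add_distrib]
    rw [sub_eq_add_neg]
    congr 1
    rw [Finset.sum_eq_single j]
    · simp
    · intro b _ hb
      simp [hb]
    · simp
  rw [h2]
  ring

/-- Differentiate the translation identity at $s=0$, under the integral on one side and explicitly
on the other. The factor `a j` is the chain rule for coordinates of period 1. -/
theorem torusCoeff_partial {a : Fin d → ℝ} (f : smoothTorusFunctions a) (k : Fin d → ℤ)
    (j : Fin d) :
    2 * Real.pi * Complex.I * k j * torusCoeff f k = a j * torusCoeff (torusPartial j f) k := by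
  set φ : ℝ → UnitAddTorus (Fin d) → ℂ := fun s y =>
    UnitAddTorus.mFourier (-k) y * unitLift f (y + torusProj d (Pi.single j s)) with hφ
  set φ' : ℝ → UnitAddTorus (Fin d) → ℂ := fun s y => UnitAddTorus.mFourier (-k) y *
    (a j * unitLift (torusPartial j f) (y + torusProj d (Pi.single j s))) with hφ'
  have hcont : ∀ s, Continuous (φ s) := fun s => by simp only [hφ]; fun_prop
  have hcont' : ∀ s, Continuous (φ' s) := fun s => by simp only [hφ']; fun_prop
  have hbound : ∀ s y, ‖φ' s y‖ ≤ |a j| * ‖unitLift (torusPartial j f)‖ := by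
    intro s y
    simp only [hφ', norm_mul]
    have h1 : ‖UnitAddTorus.mFourier (-k) y‖ ≤ 1 :=
      ((UnitAddTorus.mFourier (-k)).norm_coe_le_norm y).trans UnitAddTorus.mFourier_norm.le
    have h2 := (unitLift (torusPartial j f)).norm_coe_le_norm
      (y + torusProj d (Pi.single j s))
    rw [Complex.norm_real, Real.norm_eq_abs]
    calc _ ≤ 1 * (|a j| * ‖unitLift (torusPartial j f)‖) := by gcongr
      _ = _ := one_mul _
  have hderiv : ∀ s y, HasDerivAt (fun s => φ s y) (φ' s y) s := by
    intro s y
    obtain ⟨z, rfl⟩ := torusProj_surjective d y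
    have h : ∀ s, torusProj d z + torusProj d (Pi.single j s) =
      torusProj d (z + Pi.single j s) := fun _ => rfl
    simp only [hφ, hφ', h, unitLift_apply, scalePoint_add_single]
    refine HasDerivAt.const_mul _ ?_
    have hf : DifferentiableAt ℝ (f : EuclideanSpace ℝ (Fin d) → ℂ)
        (scalePoint a z + s • a j • EuclideanSpace.single j (1 : ℝ)) :=
      (f.2.1.differentiable (by simp)).differentiableAt
    have hl : HasDerivAt (fun s : ℝ => scalePoint a z + s • a j • EuclideanSpace.single j (1 : ℝ))
        (a j • EuclideanSpace.single j (1 : ℝ)) s := by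
      simpa using ((hasDerivAt_id s).smul_const
        (a j • EuclideanSpace.single j (1 : ℝ))).const_add (scalePoint a z)
    have := hf.hasFDerivAt.comp_hasDerivAt s hl
    rw [map_smul, Complex.real_smul] at this
    exact this
  have h1 := (hasDerivAt_integral_of_dominated_loc_of_deriv_le (μ := torusMeasure d) (𝕜 := ℝ)
    (F := φ) (F' := φ') (x₀ := 0) (s := univ)
    (bound := fun _ => |a j| * ‖unitLift (torusPartial j f)‖) univ_mem
    (Eventually.of_forall fun s => (hcont s).aestronglyMeasurable)
    ((hcont 0).integrable_of_hasCompactSupport (HasCompactSupport.of_compactSpace _))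
    (hcont' 0).aestronglyMeasurable (Eventually.of_forall fun y s _ => hbound s y)
    (integrable_const _) (Eventually.of_forall fun y s _ => hderiv s y)).2
  have h2 : HasDerivAt (fun s : ℝ => Complex.exp (2 * Real.pi * Complex.I * k j * s) *
      torusCoeff f k) (2 * Real.pi * Complex.I * k j * torusCoeff f k) 0 := by
    have h3 : HasDerivAt (fun s : ℝ => 2 * Real.pi * Complex.I * k j * (s : ℂ))
        (2 * Real.pi * Complex.I * k j) 0 := by
      simpa using (Complex.ofRealCLM.hasDerivAt (x := (0 : ℝ))).const_mul
        (2 * Real.pi * Complex.I * k j)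
    simpa using (h3.cexp).mul_const (torusCoeff f k)
  have h4 : (fun s => ∫ y, φ s y ∂(torusMeasure d)) = fun s : ℝ =>
      Complex.exp (2 * Real.pi * Complex.I * k j * s) * torusCoeff f k :=
    funext fun s => integral_mFourier_mul_translate (unitLift f) k j s
  rw [h4] at h1
  rw [h2.unique h1, torusCoeff_eq, ← integral_const_mul]
  congr 1
  funext y
  have h0 : torusProj d (Pi.single j 0) = 0 := by
    rw [Pi.single_zero]
    rfl
  simp only [hφ', h0, add_zero]
  ring

end TorusFunctions


/-! ### Spectrum and heat trace of the flat torus -/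

section TorusSpectrum

variable {d : ℕ}

/-- The eigenvalues of the massive Laplacian of the torus. -/
def torusEigenvalue (a : Fin d → ℝ) (m : ℝ) (k : Fin d → ℤ) : ℝ :=
  ∑ j, (2 * Real.pi / a j) ^ 2 * (k j : ℝ) ^ 2 + m ^ 2

theorem unitLift_add {a : Fin d → ℝ} (f g : smoothTorusFunctions a) :
    unitLift (f + g) = unitLift f + unitLift g := by
  ext y
  obtain ⟨z, rfl⟩ := torusProj_surjective d y
  simp [unitLift_apply]

theorem unitLift_smul {a : Fin d → ℝ} (c : ℂ) (f : smoothTorusFunctions a) :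
    unitLift (c • f) = c • unitLift f := by
  ext y
  obtain ⟨z, rfl⟩ := torusProj_surjective d y
  simp [unitLift_apply]

/-- The Fourier coefficient as a linear functional. -/
def torusCoeffLinear (a : Fin d → ℝ) (k : Fin d → ℤ) : smoothTorusFunctions a →ₗ[ℂ] ℂ where
  toFun f := torusCoeff f k
  map_add' f g := by
    have h : ∀ F : C(UnitAddTorus (Fin d), ℂ),
        Integrable (fun y => UnitAddTorus.mFourier (-k) y * F y) (torusMeasure d) := fun F =>
      Continuous.integrable_of_hasCompactSupport (by fun_prop) (HasCompactSupport.of_compactSpace _)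
    simp only [torusCoeff_eq]
    rw [← integral_add (h _) (h _), unitLift_add]
    simp only [ContinuousMap.add_apply, mul_add]
  map_smul' c f := by
    simp only [torusCoeff_eq, RingHom.id_apply, smul_eq_mul]
    rw [← integral_const_mul, unitLift_smul]
    simp only [ContinuousMap.smul_apply, smul_eq_mul, mul_left_comm]

theorem torusLaplacian_eq (a : Fin d → ℝ) (m : ℝ) (f : smoothTorusFunctions a) :
    torusLaplacian a m f =
      -∑ j, torusPartial j (torusPartial j f) + ((m : ℂ) ^ 2) • f := by
  ext x
  change -Laplacian.laplacian (f : EuclideanSpace ℝ (Fin d) → ℂ) x + _ = _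
  rw [laplacian_eq_sum_partialDeriv f.2.1]
  simp [torusPartial]

theorem torusCoeff_torusLaplacian {a : Fin d → ℝ} (ha : ∀ j, 0 < a j) (m : ℝ)
    (f : smoothTorusFunctions a) (k : Fin d → ℤ) :
    torusCoeff (torusLaplacian a m f) k = torusEigenvalue a m k * torusCoeff f k := by
  have h : ∀ j (g : smoothTorusFunctions a), torusCoeffLinear a k (torusPartial j g) =
      2 * Real.pi * Complex.I * k j / a j * torusCoeffLinear a k g := by
    intro j g
    have h1 := torusCoeff_partial g k j
    have h2 : (a j : ℂ) ≠ 0 := Complex.ofReal_ne_zero.2 (ha j).ne'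
    change torusCoeff (torusPartial j g) k = _ * torusCoeff g k
    rw [div_mul_eq_mul_div, h1, mul_div_cancel_left₀ _ h2]
  change torusCoeffLinear a k (torusLaplacian a m f) = _ * torusCoeffLinear a k f
  rw [torusLaplacian_eq, map_add, map_neg, map_sum, map_smul, torusEigenvalue]
  simp only [h]
  push_cast
  rw [add_mul, Finset.sum_mul, ← Finset.sum_neg_distrib, smul_eq_mul]
  congr 1
  refine Finset.sum_congr rfl fun j _ => ?_
  ring_nf
  rw [Complex.I_sq]
  ring

/-- The linear form in the exponent of the exponential of frequency `k`. -/
def torusPhase (a : Fin d → ℝ) (k : Fin d → ℤ) : EuclideanSpace ℝ (Fin d) →L[ℝ] ℂ :=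
  ∑ j, (2 * Real.pi * Complex.I * k j / a j) •
    (Complex.ofRealCLM ∘L (EuclideanSpace.proj j : EuclideanSpace ℝ (Fin d) →L[ℝ] ℝ))

theorem torusPhase_apply (a : Fin d → ℝ) (k : Fin d → ℤ) (x : EuclideanSpace ℝ (Fin d)) :
    torusPhase a k x = ∑ j, 2 * Real.pi * Complex.I * k j / a j * (x j : ℂ) := by
  simp [torusPhase]

theorem torusPhase_single (a : Fin d → ℝ) (k : Fin d → ℤ) (j : Fin d) (s : ℝ) :
    torusPhase a k (EuclideanSpace.single j s) = 2 * Real.pi * Complex.I * k j / a j * s := by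
  rw [torusPhase_apply, Finset.sum_eq_single j]
  · simp
  · intro b _ hb
    simp [hb]
  · simp

/-- The exponential of frequency `k` on the torus. -/
def torusExp {a : Fin d → ℝ} (ha : ∀ j, 0 < a j) (k : Fin d → ℤ) : smoothTorusFunctions a :=
  ⟨fun x => Complex.exp (torusPhase a k x), (torusPhase a k).contDiff.cexp, fun j x => by
    have h : (a j : ℂ) ≠ 0 := Complex.ofReal_ne_zero.2 (ha j).ne'
    simp only [map_add, torusPhase_single]
    rw [div_mul_cancel₀ _ h, mul_comm _ (k j : ℂ)]
    exact Complex.exp_periodic.int_mul (k j) _⟩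

theorem torusExp_apply {a : Fin d → ℝ} (ha : ∀ j, 0 < a j) (k : Fin d → ℤ)
    (x : EuclideanSpace ℝ (Fin d)) :
    (torusExp ha k : EuclideanSpace ℝ (Fin d) → ℂ) x = Complex.exp (torusPhase a k x) := rfl

theorem torusPartial_torusExp {a : Fin d → ℝ} (ha : ∀ j, 0 < a j) (k : Fin d → ℤ) (j : Fin d) :
    torusPartial j (torusExp ha k) = (2 * Real.pi * Complex.I * k j / a j) • torusExp ha k := by
  ext x
  have h : HasFDerivAt (fun x => Complex.exp (torusPhase a k x)) _ x :=
    (torusPhase a k).hasFDerivAt.cexp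
  change fderiv ℝ (fun x => Complex.exp (torusPhase a k x)) x (EuclideanSpace.single j 1) =
    _ * Complex.exp (torusPhase a k x)
  rw [h.fderiv, smul_apply, torusPhase_single, smul_eq_mul]
  push_cast
  ring

theorem torusPartial_smul {a : Fin d → ℝ} (j : Fin d) (c : ℂ) (f : smoothTorusFunctions a) :
    torusPartial j (c • f) = c • torusPartial j f := by
  ext x
  have h : DifferentiableAt ℝ (f : EuclideanSpace ℝ (Fin d) → ℂ) x :=
    (f.2.1.differentiable (by simp)).differentiableAt
  change fderiv ℝ (c • (f : EuclideanSpace ℝ (Fin d) → ℂ)) x (EuclideanSpace.single j 1) =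
    c * fderiv ℝ (f : EuclideanSpace ℝ (Fin d) → ℂ) x (EuclideanSpace.single j 1)
  rw [fderiv_const_smul h]
  rfl

theorem torusLaplacian_torusExp {a : Fin d → ℝ} (ha : ∀ j, 0 < a j) (m : ℝ) (k : Fin d → ℤ) :
    torusLaplacian a m (torusExp ha k) = (torusEigenvalue a m k : ℂ) • torusExp ha k := by
  rw [torusLaplacian_eq, torusEigenvalue]
  simp only [torusPartial_torusExp, torusPartial_smul, smul_smul]
  rw [← Finset.sum_smul, ← neg_smul, ← add_smul]
  congr 1
  push_cast
  rw [← Finset.sum_neg_distrib]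
  congr 1
  refine Finset.sum_congr rfl fun j _ => ?_
  ring_nf
  rw [Complex.I_sq]
  ring

theorem torusExp_injective {a : Fin d → ℝ} (ha : ∀ j, 0 < a j) :
    Function.Injective (torusExp ha) := by
  intro k l h
  funext j
  have h1 := torusPartial_torusExp ha k j
  rw [h, torusPartial_torusExp ha l j] at h1
  have h2 : ((2 * Real.pi * Complex.I * l j / a j) • torusExp ha l :
      smoothTorusFunctions a).1 0 = ((2 * Real.pi * Complex.I * k j / a j) • torusExp ha l :
      smoothTorusFunctions a).1 0 := by rw [h1]
  change _ * Complex.exp (torusPhase a l 0) = _ * Complex.exp (torusPhase a l 0) at h2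
  have h3 := mul_right_cancel₀ (Complex.exp_ne_zero _) h2
  have h4 : (a j : ℂ) ≠ 0 := Complex.ofReal_ne_zero.2 (ha j).ne'
  have h5 := mul_left_cancel₀ Complex.two_pi_I_ne_zero ((div_left_inj' h4).1 h3)
  exact_mod_cast h5.symm

/-- Independence of distinct characters of the additive group $\mathbb R^d$. -/
theorem linearIndependent_torusExp {a : Fin d → ℝ} (ha : ∀ j, 0 < a j) :
    LinearIndependent ℂ (torusExp ha) := by
  refine LinearIndependent.of_comp (smoothTorusFunctions a).subtype ?_
  let χ : (Fin d → ℤ) → (Multiplicative (EuclideanSpace ℝ (Fin d)) →* ℂ) := fun k =>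
    { toFun := fun x => Complex.exp (torusPhase a k x.toAdd)
      map_one' := by simp
      map_mul' := fun x y => by simp [Complex.exp_add] }
  have h := (linearIndependent_monoidHom (Multiplicative (EuclideanSpace ℝ (Fin d))) ℂ).comp χ
    fun k l h => torusExp_injective ha (Subtype.ext (funext fun x => DFunLike.congr_fun h x))
  exact h

theorem unitLift_torusExp {a : Fin d → ℝ} (ha : ∀ j, 0 < a j) (k : Fin d → ℤ) :
    unitLift (torusExp ha k) = UnitAddTorus.mFourier k := by
  ext y
  obtain ⟨z, rfl⟩ := torusProj_surjective d y
  rw [unitLift_apply, mFourier_torusProj, torusExp_apply, torusPhase_apply, Finset.mul_sum]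
  congr 1
  refine Finset.sum_congr rfl fun j _ => ?_
  have h4 : (a j : ℂ) ≠ 0 := Complex.ofReal_ne_zero.2 (ha j).ne'
  simp only [scalePoint]
  push_cast
  field_simp

theorem unitLift_injective {a : Fin d → ℝ} (ha : ∀ j, 0 < a j) :
    Function.Injective (unitLift (a := a)) := by
  intro f g h
  ext x
  have hx : x = scalePoint a fun j => x j / a j := by
    ext j
    simp only [scalePoint]
    rw [mul_div_cancel₀ _ (ha j).ne']
  rw [hx, ← unitLift_apply, ← unitLift_apply, h]

/-- A smooth function on the torus with finitely many nonzero Fourier coefficients is a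
trigonometric polynomial. -/
theorem eq_sum_torusExp {a : Fin d → ℝ} (ha : ∀ j, 0 < a j) (f : smoothTorusFunctions a)
    (s : Finset (Fin d → ℤ)) (hs : ∀ k ∉ s, torusCoeff f k = 0) :
    f = ∑ k ∈ s, torusCoeff f k • torusExp ha k := by
  apply unitLift_injective ha
  have hsum : unitLift (∑ k ∈ s, torusCoeff f k • torusExp ha k) =
      ∑ k ∈ s, torusCoeff f k • UnitAddTorus.mFourier k := by
    let L : smoothTorusFunctions a →ₗ[ℂ] C(UnitAddTorus (Fin d), ℂ) :=
      { toFun := unitLift, map_add' := unitLift_add, map_smul' := unitLift_smul }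
    change L _ = _
    rw [map_sum]
    refine Finset.sum_congr rfl fun k _ => ?_
    rw [map_smul]
    congr 1
    exact unitLift_torusExp ha k
  rw [hsum]
  have h1 : Summable (UnitAddTorus.mFourierCoeff (unitLift f)) :=
    summable_of_ne_finset_zero (s := s) hs
  refine (UnitAddTorus.hasSum_mFourier_series_of_summable h1).unique ?_
  refine hasSum_sum_of_ne_finset_zero fun k hk => ?_
  have : UnitAddTorus.mFourierCoeff (unitLift f) k = 0 := hs k hk
  rw [this]
  ext y
  exact zero_mul _

/-- The Laplacian multiplies Fourier coefficients by the eigenvalues, so the coefficients of an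
eigenfunction vanish off a finite set of frequencies and the function is a trigonometric polynomial.
-/
theorem mem_span_torusExp {a : Fin d → ℝ} (ha : ∀ j, 0 < a j) {m lam : ℝ}
    (hfin : Finite {k // torusEigenvalue a m k = lam}) (f : smoothTorusFunctions a)
    (hf : torusLaplacian a m f = (lam : ℂ) • f) :
    f ∈ Submodule.span ℂ
      (range fun k : {k // torusEigenvalue a m k = lam} => torusExp ha (k : Fin d → ℤ)) := by
  have hfin' : {k | torusEigenvalue a m k = lam}.Finite := hfin
  rw [eq_sum_torusExp ha f hfin'.toFinset fun k hk => ?_]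
  · refine Submodule.sum_mem _ fun k hk => Submodule.smul_mem _ _ (Submodule.subset_span ?_)
    exact ⟨⟨k, hfin'.mem_toFinset.1 hk⟩, rfl⟩
  · by_contra h0
    have h1 := torusCoeff_torusLaplacian ha m f k
    rw [hf] at h1
    have h2 : torusCoeff ((lam : ℂ) • f) k = lam * torusCoeff f k :=
      (torusCoeffLinear a k).map_smul _ _
    rw [h2] at h1
    have h3 := mul_right_cancel₀ h0 h1
    exact hk (hfin'.mem_toFinset.2 (by exact_mod_cast h3.symm))

theorem hasSum_mul_of_nonneg {ι κ : Type*} {f : ι → ℝ} {g : κ → ℝ} {s t : ℝ} (hf : ∀ i, 0 ≤ f i)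
    (hg : ∀ i, 0 ≤ g i) (hs : HasSum f s) (ht : HasSum g t) :
    HasSum (fun p : ι × κ => f p.1 * g p.2) (s * t) :=
  hs.mul ht (hs.summable.mul_of_nonneg ht.summable hf hg)

theorem hasSum_prod_pi {d : ℕ} {f : Fin d → ℤ → ℝ} {S : Fin d → ℝ} (hf : ∀ j z, 0 ≤ f j z)
    (h : ∀ j, HasSum (f j) (S j)) :
    HasSum (fun k : Fin d → ℤ => ∏ j, f j (k j)) (∏ j, S j) := by
  induction d with
  | zero => simp
  | succ n ih =>
    have h1 := ih (f := fun j => f j.succ) (fun j z => hf j.succ z) fun j => h j.succ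
    have h2 := hasSum_mul_of_nonneg (hf 0)
      (fun k => Finset.prod_nonneg fun j _ => hf j.succ (k j)) (h 0) h1
    rw [Fin.prod_univ_succ, ← (Fin.consEquiv fun _ : Fin (n + 1) => ℤ).hasSum_iff]
    refine h2.congr_fun fun p => ?_
    simp [Fin.consEquiv, Fin.prod_univ_succ]

theorem hasSum_torusEigenvalue {a : Fin d → ℝ} (ha : ∀ j, 0 < a j) (m : ℝ) {t : ℝ} (ht : 0 < t) :
    HasSum (fun k => Real.exp (-(torusEigenvalue a m k * t)))
      (Real.exp (-(m ^ 2 * t)) * ∏ j, circleTheta (a j) t) := by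
  have h := hasSum_prod_pi (f := fun j (z : ℤ) =>
    Real.exp (-((2 * Real.pi / a j) ^ 2 * t * (z : ℝ) ^ 2))) (S := fun j => circleTheta (a j) t)
    (fun _ _ => (Real.exp_pos _).le) fun j => (summable_gaussSum (by
      have := ha j
      positivity)).hasSum
  refine (h.mul_left (Real.exp (-(m ^ 2 * t)))).congr_fun fun k => ?_
  rw [← Real.exp_sum, ← Real.exp_add, torusEigenvalue, add_mul, Finset.sum_mul, neg_add_rev,
    Finset.sum_neg_distrib]
  congr 3
  refine Finset.sum_congr rfl fun j _ => ?_
  ring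

/-- An infinite fibre would put infinitely many copies of one positive number into the convergent
heat trace at time 1. -/
theorem finite_torusEigenvalue {a : Fin d → ℝ} (ha : ∀ j, 0 < a j) (m lam : ℝ) :
    Finite {k // torusEigenvalue a m k = lam} := by
  by_contra h
  rw [not_finite_iff_infinite] at h
  have h1 := ((hasSum_torusEigenvalue ha m one_pos).summable).comp_injective
    (Subtype.val_injective (p := fun k => torusEigenvalue a m k = lam))
  have h2 : ((fun k => Real.exp (-(torusEigenvalue a m k * 1))) ∘ Subtype.val :
      {k // torusEigenvalue a m k = lam} → ℝ) = fun _ => Real.exp (-(lam * 1)) := by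
    funext k
    simp only [Function.comp, k.2]
  rw [h2, summable_const_iff] at h1
  exact (Real.exp_pos _).ne' h1

theorem eigenspace_torusLaplacian {a : Fin d → ℝ} (ha : ∀ j, 0 < a j) (m lam : ℝ) :
    FiniteDimensional ℂ ((torusLaplacian a m).eigenspace (lam : ℂ)) ∧
      Module.finrank ℂ ((torusLaplacian a m).eigenspace (lam : ℂ)) =
        Nat.card {k // torusEigenvalue a m k = lam} :=
  finrank_eigenspace_eq_card _ (torusExp ha) _ (linearIndependent_torusExp ha)
    (torusLaplacian_torusExp ha m) (finite_torusEigenvalue ha m)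
    (fun lam f hf => mem_span_torusExp ha (finite_torusEigenvalue ha m lam) f hf) lam

theorem hasSum_theta_torusLaplacian {a : Fin d → ℝ} (ha : ∀ j, 0 < a j) (m : ℝ) {t : ℝ}
    (ht : 0 < t) :
    HasSum (fun lam : ℝ =>
      (Module.finrank ℂ ((torusLaplacian a m).eigenspace (lam : ℂ)) : ℝ) * Real.exp (-(lam * t)))
      (Real.exp (-(m ^ 2 * t)) * ∏ j, circleTheta (a j) t) :=
  hasSum_theta_of_hasSum _ _ (finite_torusEigenvalue ha m)
    (fun lam => (eigenspace_torusLaplacian ha m lam).2) (hasSum_torusEigenvalue ha m ht)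

theorem theta_torusLaplacian {a : Fin d → ℝ} (ha : ∀ j, 0 < a j) (m : ℝ) {t : ℝ} (ht : 0 < t) :
    theta (torusLaplacian a m) t = Real.exp (-(m ^ 2 * t)) * ∏ j, circleTheta (a j) t :=
  (hasSum_theta_torusLaplacian ha m ht).tsum_eq

end TorusSpectrum


/-! ### The Gamma quotient at 0 and the explicit constant -/

section GammaRatio

/-- The meromorphic continuation of `Γ(s - d/2) / Γ(s)` that is regular at `0`. -/
def gammaRatio (d : ℕ) (s : ℂ) : ℂ :=
  if Odd d then (Complex.Gamma s)⁻¹ * (Complex.Gamma (s - d / 2))⁻¹⁻¹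
  else ∏ j ∈ Finset.range (d / 2), (s - (j + 1))⁻¹

theorem analyticAt_inv_Gamma_comp_sub (c s : ℂ) :
    AnalyticAt ℂ (fun s => (Complex.Gamma (s - c))⁻¹) s :=
  (Complex.differentiable_one_div_Gamma.comp (differentiable_id.sub_const c)).analyticAt s

theorem analyticAt_inv_Gamma (s : ℂ) : AnalyticAt ℂ (fun s => (Complex.Gamma s)⁻¹) s :=
  Complex.differentiable_one_div_Gamma.analyticAt s

/-- The double inverse in the odd case expresses Γ through the entire function $1/\Gamma$. In the
even case the quotient is already rational. -/
theorem meromorphicAt_gammaRatio (d : ℕ) (s : ℂ) : MeromorphicAt (gammaRatio d) s := by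
  unfold gammaRatio
  by_cases h : Odd d
  · simp only [if_pos h]
    exact (analyticAt_inv_Gamma s).meromorphicAt.fun_mul
      (analyticAt_inv_Gamma_comp_sub _ s).meromorphicAt.fun_inv
  · simp only [if_neg h]
    refine MeromorphicAt.fun_prod fun j _ => MeromorphicAt.fun_inv ?_
    exact AnalyticAt.meromorphicAt (by fun_prop)

theorem Gamma_neg_half_odd_ne_zero {d : ℕ} (h : Odd d) : Complex.Gamma (0 - d / 2) ≠ 0 := by
  refine Complex.Gamma_ne_zero fun k hk => ?_
  have h1 : (d : ℂ) = (2 * k : ℕ) := by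
    push_cast
    linear_combination -2 * hk
  have h2 : d = 2 * k := by exact_mod_cast h1
  exact (Nat.not_even_iff_odd.2 h) ⟨k, by omega⟩

theorem analyticAt_gammaRatio_zero (d : ℕ) : AnalyticAt ℂ (gammaRatio d) 0 := by
  unfold gammaRatio
  by_cases h : Odd d
  · simp only [if_pos h]
    exact (analyticAt_inv_Gamma 0).fun_mul ((analyticAt_inv_Gamma_comp_sub _ 0).fun_inv
      (inv_ne_zero (Gamma_neg_half_odd_ne_zero h)))
  · simp only [if_neg h]
    refine Finset.analyticAt_fun_prod _ fun j _ => AnalyticAt.fun_inv (by fun_prop) ?_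
    rw [zero_sub]
    exact neg_ne_zero.2 (Nat.cast_add_one_ne_zero j)

theorem Gamma_sub_nat (k : ℕ) {s : ℂ} (hs : (k : ℝ) < s.re) :
    Complex.Gamma (s - k) = Complex.Gamma s * ∏ j ∈ Finset.range k, (s - (j + 1))⁻¹ := by
  induction k with
  | zero => simp
  | succ k ih =>
    push_cast at hs
    have hne : s - (k + 1) ≠ 0 := fun h => by
      have := congrArg Complex.re h
      simp at this
      linarith
    rw [Finset.prod_range_succ, ← mul_assoc, ← ih (by linarith)]
    have h1 := Complex.Gamma_add_one _ hne
    have h2 : s - (k + 1) + 1 = s - k := by ring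
    rw [h2] at h1
    rw [h1]
    push_cast
    field_simp

theorem gammaRatio_eq {d : ℕ} {s : ℂ} (hs : (d : ℝ) / 2 < s.re) :
    gammaRatio d s = (Complex.Gamma s)⁻¹ * Complex.Gamma (s - d / 2) := by
  unfold gammaRatio
  split_ifs with h
  · rw [inv_inv]
  · obtain ⟨k, rfl⟩ := Nat.not_odd_iff_even.1 h
    have h1 : (k + k) / 2 = k := by omega
    have h2 : (((k + k : ℕ) : ℂ)) / 2 = k := by push_cast; ring
    have h3 : (k : ℝ) < s.re := by push_cast at hs; linarith
    have h4 : (0 : ℝ) ≤ k := k.cast_nonneg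
    rw [h1, h2, Gamma_sub_nat k h3,
      inv_mul_cancel_left₀ (Complex.Gamma_ne_zero_of_re_pos (h4.trans_lt h3))]

/-- From $1/\Gamma(s)=s/\Gamma(s+1)$. -/
theorem hasDerivAt_inv_Gamma_zero : HasDerivAt (fun s => (Complex.Gamma s)⁻¹) 1 0 := by
  have h1 : DifferentiableAt ℂ (fun s => (Complex.Gamma (s + 1))⁻¹) 0 :=
    (Complex.differentiable_one_div_Gamma.comp (differentiable_id.add_const 1)).differentiableAt
  have h2 := (hasDerivAt_id (0 : ℂ)).mul h1.hasDerivAt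
  simp only [id, zero_add, Complex.Gamma_one, inv_one, mul_one, zero_mul, add_zero] at h2
  refine h2.congr_of_eventuallyEq (Eventually.of_forall fun s => ?_)
  exact Complex.one_div_Gamma_eq_self_mul_one_div_Gamma_add_one s

/-- The logarithmic derivative at 0 is $\sum_j1/j$; this is the source of the harmonic sum in the
even-dimensional constant. -/
theorem hasDerivAt_prod_inv (k : ℕ) :
    ∏ j ∈ Finset.range k, ((0 : ℂ) - (j + 1))⁻¹ = (-1) ^ k / k.factorial ∧
    HasDerivAt (fun s : ℂ => ∏ j ∈ Finset.range k, (s - (j + 1))⁻¹)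
      ((-1) ^ k / k.factorial * ∑ j ∈ Finset.Icc 1 k, 1 / (j : ℂ)) 0 := by
  induction k with
  | zero => simp [hasDerivAt_const]
  | succ k ih =>
    have hk : (k : ℂ) + 1 ≠ 0 := Nat.cast_add_one_ne_zero k
    have hk2 : (0 : ℂ) - (k + 1) ≠ 0 := by rw [zero_sub]; exact neg_ne_zero.2 hk
    have hf : (k.factorial : ℂ) ≠ 0 := Nat.cast_ne_zero.2 k.factorial_ne_zero
    constructor
    · rw [Finset.prod_range_succ, ih.1, Nat.factorial_succ]
      push_cast
      rw [zero_sub, inv_neg, pow_succ]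
      field_simp
    · have h1 : HasDerivAt (fun s : ℂ => (s - (k + 1))⁻¹) (-1 / (0 - ((k : ℂ) + 1)) ^ 2) 0 :=
        ((hasDerivAt_id (0 : ℂ)).sub_const _).fun_inv hk2
      have h2 := ih.2.fun_mul h1
      simp only [Finset.prod_range_succ]
      refine h2.congr_deriv ?_
      rw [ih.1, Finset.sum_Icc_succ_top (by omega), Nat.factorial_succ]
      push_cast
      rw [zero_sub, inv_neg, pow_succ]
      field_simp
      ring

/-- The coefficient `∏ a_j / (4π)^{d/2}` of the leading term of the heat trace. -/
def heatCoeff {d : ℕ} (a : Fin d → ℝ) : ℝ := (∏ j, a j) / √(4 * Real.pi) ^ d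

/-- The explicit term comes from the derivative of the leading part of the zeta function. -/
theorem exists_hasDerivAt_gammaRatio {d : ℕ} (a : Fin d → ℝ) {m : ℝ} (hm : 0 < m) :
    ∃ r : ℂ, HasDerivAt (gammaRatio d) r 0 ∧
      (explicitTerm a m : ℂ) =
        heatCoeff a * m ^ d * (r - Real.log (m ^ 2) * gammaRatio d 0) := by
  have hs : (√(4 * Real.pi) : ℝ) ≠ 0 := (Real.sqrt_pos.2 (by positivity)).ne'
  by_cases h : Odd d
  -- In odd dimension the quotient vanishes at 0, so the logarithm drops out and only $\Gamma(-d/2)$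
  -- remains.
  · refine ⟨Complex.Gamma (0 - d / 2), ?_, ?_⟩
    · have h1 := ((analyticAt_inv_Gamma_comp_sub (d / 2) 0).fun_inv
        (inv_ne_zero (Gamma_neg_half_odd_ne_zero h))).differentiableAt.hasDerivAt
      have h2 := hasDerivAt_inv_Gamma_zero.fun_mul h1
      rw [Complex.Gamma_zero, inv_zero, zero_mul, add_zero, one_mul, inv_inv] at h2
      unfold gammaRatio
      simpa only [if_pos h] using h2
    · have h0 : gammaRatio d 0 = 0 := by simp [gammaRatio, h]
      have h1 : Complex.Gamma (0 - d / 2) = ((Real.Gamma (-(d : ℝ) / 2) : ℝ) : ℂ) := by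
        rw [← Complex.Gamma_ofReal]
        congr 1
        push_cast
        ring
      have h2 : (4 * Real.pi / m ^ 2) ^ ((d : ℝ) / 2) = √(4 * Real.pi) ^ d / m ^ d := by
        rw [Real.rpow_div_two_eq_sqrt _ (by positivity), Real.rpow_natCast,
          Real.sqrt_div (by positivity), Real.sqrt_sq hm.le, div_pow]
      rw [h0, h1, explicitTerm, if_pos h, h2, heatCoeff]
      norm_cast
      rw [mul_zero, sub_zero]
      field_simp
  · obtain ⟨k, hk⟩ := Nat.not_odd_iff_even.1 h
    have hk2 : d / 2 = k := by omega
    have h1 := hasDerivAt_prod_inv k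
    refine ⟨(-1) ^ k / k.factorial * ∑ j ∈ Finset.Icc 1 k, 1 / (j : ℂ), ?_, ?_⟩
    · unfold gammaRatio
      simp only [if_neg h, hk2]
      exact h1.2
    · have h0 : gammaRatio d 0 = (-1) ^ k / k.factorial := by
        rw [← h1.1]
        simp only [gammaRatio, if_neg h, hk2]
      have h3 : √(4 * Real.pi) ^ d = (4 * Real.pi) ^ k := by
        rw [hk, ← two_mul, pow_mul, Real.sq_sqrt (by positivity)]
      rw [h0, explicitTerm, if_neg h, hk2, heatCoeff, h3]
      push_cast
      ring

end GammaRatio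

/-! ### Continuation of the zeta function and its derivative at 0 -/

section Defect

variable {d : ℕ}

/-- The massless theta function of the torus minus its leading small time term. -/
def torusDefect (a : Fin d → ℝ) (t : ℝ) : ℝ :=
  ∏ j, circleTheta (a j) t - ∏ j, a j / √(4 * Real.pi * t)

theorem tendsto_discreteDefect {a : Fin d → ℝ} (ha : ∀ j, 0 < a j) {N : ℝ → Fin d → ℕ}
    (hN : ∀ u, 0 < u → ∀ j, 0 < N u j)
    (hNa : ∀ j, Tendsto (fun u : ℝ => (N u j : ℝ) / u) atTop (𝓝 (a j))) {t : ℝ} (ht : 0 < t) :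
    Tendsto (fun u => discreteDefect (N u) (u ^ 2 * t)) atTop (𝓝 (torusDefect a t)) :=
  (tendsto_finsetProd _ fun j _ =>
    tendsto_cycleTheta (ha j) (fun u hu => hN u hu j) (hNa j) ht).sub
    (tendsto_finsetProd _ fun j _ => tendsto_mul_latticeKernel_scaled (hNa j) ht)

/-- Both bounds pass to the limit from the discrete tori with side lengths $\lceil a_ju\rceil$, so
no separate small-time analysis on the torus is needed. -/
theorem exists_torusDefect_le {a : Fin d → ℝ} (ha : ∀ j, 0 < a j) (Q : ℕ) :
    ∃ C, 0 ≤ C ∧ ∀ t, 0 < t → 0 ≤ torusDefect a t ∧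
      torusDefect a t ≤ C * t ^ (Q + 1) * (1 + t) ^ d := by
  have hN : ∀ u : ℝ, 0 < u → ∀ j, 0 < ⌈a j * u⌉₊ :=
    fun u hu j => Nat.ceil_pos.2 (mul_pos (ha j) hu)
  have hNa : ∀ j, Tendsto (fun u : ℝ => (⌈a j * u⌉₊ : ℝ) / u) atTop (𝓝 (a j)) :=
    fun j => tendsto_nat_ceil_mul_div_atTop (ha j).le
  obtain ⟨C, hC, h⟩ := eventually_discreteDefect_le (N := fun u j => ⌈a j * u⌉₊) ha hN hNa Q
  refine ⟨C, hC, fun t ht => ⟨?_, ?_⟩⟩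
  · refine ge_of_tendsto (tendsto_discreteDefect ha hN hNa ht) ?_
    filter_upwards [eventually_gt_atTop 0] with u hu
    have : ∀ j, NeZero ⌈a j * u⌉₊ := fun j => ⟨(hN u hu j).ne'⟩
    exact discreteDefect_nonneg _ (by positivity)
  · exact le_of_tendsto (tendsto_discreteDefect ha hN hNa ht) (h.mono fun u hu => hu t ht)

theorem continuousOn_gaussSum : ContinuousOn gaussSum (Ioi 0) := by
  refine continuousOn_of_forall_continuousAt fun x hx => ?_
  have hx : 0 < x := hx
  have h : ContinuousOn gaussSum (Ioi (x / 2)) := by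
    refine continuousOn_tsum (fun z => by fun_prop) (summable_gaussSum (half_pos hx))
      fun z y hy => ?_
    rw [Real.norm_eq_abs, Real.abs_exp]
    exact Real.exp_le_exp.2 (neg_le_neg (mul_le_mul_of_nonneg_right (le_of_lt hy) (sq_nonneg _)))
  exact h.continuousAt (Ioi_mem_nhds (half_lt_self hx))

theorem continuousOn_torusDefect {a : Fin d → ℝ} (ha : ∀ j, 0 < a j) :
    ContinuousOn (torusDefect a) (Ioi 0) := by
  unfold torusDefect circleTheta
  refine (continuousOn_finsetProd _ fun j _ => ?_).sub (continuousOn_finsetProd _ fun j _ => ?_)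
  · have := ha j
    refine continuousOn_gaussSum.comp (by fun_prop) fun t ht => ?_
    have ht : 0 < t := ht
    exact mul_pos (by positivity) ht
  · refine ContinuousOn.div continuousOn_const (by fun_prop) fun t ht => ?_
    have ht : 0 < t := ht
    exact (Real.sqrt_pos.2 (by positivity)).ne'

/-- The theta function of the torus minus its leading small time term. -/
def massiveDefect (a : Fin d → ℝ) (m t : ℝ) : ℂ :=
  ((Real.exp (-(m ^ 2 * t)) * torusDefect a t : ℝ) : ℂ)

theorem isBigO_poly_mul_exp (d : ℕ) {b c : ℝ} (h : b < c) :
    (fun t : ℝ => Real.exp (-(c * t)) * (t * (1 + t) ^ d)) =O[atTop]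
      fun t => Real.exp (-b * t) := by
  have h1 : (fun t : ℝ => t * (1 + t) ^ d) =O[atTop] fun t => t ^ (d + 1) := by
    refine Asymptotics.IsBigO.of_bound (2 ^ d) ?_
    filter_upwards [eventually_ge_atTop 1] with t ht
    have ht0 : 0 < t := by linarith
    rw [Real.norm_of_nonneg (by positivity), Real.norm_of_nonneg (by positivity), pow_succ,
      ← mul_assoc, ← mul_pow, mul_comm]
    gcongr
    linarith
  have h2 := h1.trans (isLittleO_pow_exp_pos_mul_atTop (d + 1) (sub_pos.2 h)).isBigO
  refine ((Asymptotics.isBigO_refl (fun t : ℝ => Real.exp (-(c * t))) atTop).mul h2).congr_right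
    fun t => ?_
  rw [← Real.exp_add]
  ring_nf

/-- The mass gives exponential decay at infinity, and the defect vanishes to every order at 0, so no
restriction on `s` is needed. -/
theorem mellin_massiveDefect {a : Fin d → ℝ} (ha : ∀ j, 0 < a j) {m : ℝ} (hm : 0 < m) (s : ℂ) :
    MellinConvergent (massiveDefect a m) s ∧ DifferentiableAt ℂ (mellin (massiveDefect a m)) s := by
  have hm2 : 0 < m ^ 2 / 2 := by positivity
  have hloc : LocallyIntegrableOn (massiveDefect a m) (Ioi 0) := by
    refine ContinuousOn.locallyIntegrableOn ?_ measurableSet_Ioi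
    exact Complex.continuous_ofReal.comp_continuousOn
      (ContinuousOn.mul (by fun_prop) (continuousOn_torusDefect ha))
  have hnorm : ∀ t, 0 < t → ‖massiveDefect a m t‖ =
      Real.exp (-(m ^ 2 * t)) * torusDefect a t := by
    intro t ht
    obtain ⟨C, _, h⟩ := exists_torusDefect_le ha 0
    rw [massiveDefect, Complex.norm_real,
      Real.norm_of_nonneg (mul_nonneg (Real.exp_pos _).le (h t ht).1)]
  have htop : massiveDefect a m =O[atTop] fun t => Real.exp (-(m ^ 2 / 2) * t) := by
    obtain ⟨C, hC, h⟩ := exists_torusDefect_le ha 0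
    refine Asymptotics.IsBigO.trans ?_ (isBigO_poly_mul_exp d (half_lt_self (pow_pos hm 2)))
    refine Asymptotics.IsBigO.of_bound C ?_
    filter_upwards [eventually_gt_atTop 0] with t ht
    rw [hnorm t ht, Real.norm_of_nonneg (by positivity)]
    have := mul_le_mul_of_nonneg_left (h t ht).2 (Real.exp_pos (-(m ^ 2 * t))).le
    rw [zero_add, pow_one] at this
    linarith
  have hbot : massiveDefect a m =O[𝓝[>] 0] (· ^ (-(s.re - 1))) := by
    obtain ⟨Q, hQ⟩ := exists_nat_ge (-(s.re - 1))
    obtain ⟨C, hC, h⟩ := exists_torusDefect_le ha Q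
    refine Asymptotics.IsBigO.of_bound (C * 2 ^ d) ?_
    filter_upwards [Ioc_mem_nhdsGT (zero_lt_one (α := ℝ))] with t ht
    have ht0 : 0 < t := ht.1
    have ht1 : t ≤ 1 := ht.2
    rw [hnorm t ht0, Real.norm_of_nonneg (by positivity)]
    have h1 : Real.exp (-(m ^ 2 * t)) ≤ 1 := Real.exp_le_one_iff.2 (by
      have : 0 < m ^ 2 * t := by positivity
      linarith)
    have h2 : t ^ (Q + 1) ≤ t ^ (-(s.re - 1)) := by
      rw [← Real.rpow_natCast]
      refine Real.rpow_le_rpow_of_exponent_ge ht0 ht1 ?_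
      push_cast
      linarith
    have h3 : (1 + t) ^ d ≤ 2 ^ d := by gcongr; linarith
    calc _ ≤ 1 * (C * t ^ (Q + 1) * (1 + t) ^ d) :=
          mul_le_mul h1 (h t ht0).2 (h t ht0).1 zero_le_one
      _ ≤ 1 * (C * t ^ (-(s.re - 1)) * 2 ^ d) := by gcongr
      _ = _ := by ring
  exact ⟨mellinConvergent_of_isBigO_rpow_exp hm2 hloc htop hbot (by linarith),
    mellin_differentiableAt_of_isBigO_rpow_exp hm2 hloc htop hbot (by linarith)⟩

theorem mellin_exp_neg_mul {c : ℝ} (hc : 0 < c) {s : ℂ} (hs : 0 < s.re) :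
    HasMellin (fun t : ℝ => ((Real.exp (-(c * t)) : ℝ) : ℂ)) s
      ((1 / (c : ℂ)) ^ s * Complex.Gamma s) := by
  refine ⟨?_, ?_⟩
  · refine mellinConvergent_of_isBigO_rpow_exp hc (b := 0) ?_ ?_ ?_ hs
    · exact (Continuous.locallyIntegrable (by fun_prop)).locallyIntegrableOn _
    · refine Asymptotics.IsBigO.of_bound 1 (Eventually.of_forall fun t => ?_)
      rw [Complex.norm_real, neg_mul, one_mul]
    · simp only [neg_zero, Real.rpow_zero]
      refine Asymptotics.IsBigO.of_bound 1 ?_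
      filter_upwards [self_mem_nhdsWithin] with t ht
      have ht : 0 < t := ht
      rw [Complex.norm_real, Real.norm_eq_abs, Real.abs_exp, norm_one, one_mul]
      exact Real.exp_le_one_iff.2 (by
        have : 0 < c * t := by positivity
        linarith)
  · rw [mellin, ← Complex.integral_cpow_mul_exp_neg_mul_Ioi hs hc]
    simp only [smul_eq_mul]
    push_cast
    rfl

theorem theta_eq_massiveDefect_add {a : Fin d → ℝ} (ha : ∀ j, 0 < a j) (m : ℝ) {t : ℝ}
    (ht : 0 < t) :
    (theta (torusLaplacian a m) t : ℂ) = massiveDefect a m t +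
      (heatCoeff a : ℂ) • ((t : ℂ) ^ (-(d / 2 : ℂ)) • ((Real.exp (-(m ^ 2 * t)) : ℝ) : ℂ)) := by
  have h1 : (t : ℂ) ^ (-(d / 2 : ℂ)) = (((√t ^ d)⁻¹ : ℝ) : ℂ) := by
    have h2 : √t ^ d = t ^ ((d : ℝ) / 2) := by
      rw [Real.rpow_div_two_eq_sqrt _ ht.le, Real.rpow_natCast]
    rw [h2, ← Real.rpow_neg ht.le, Complex.ofReal_cpow ht.le]
    push_cast
    rfl
  have h3 : ∏ j, a j / √(4 * Real.pi * t) = heatCoeff a * (√t ^ d)⁻¹ := by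
    rw [Finset.prod_div_distrib, Finset.prod_const, Finset.card_univ, Fintype.card_fin, heatCoeff,
      Real.sqrt_mul (by positivity), mul_pow]
    ring
  rw [theta_torusLaplacian ha m ht, h1, massiveDefect, torusDefect, h3]
  simp only [smul_eq_mul]
  push_cast
  ring

/-- The leading term $t^{-d/2}e^{-m^2t}$ is a Gamma integral shifted by $d/2$, whence the
half-plane. -/
theorem hasMellin_theta {a : Fin d → ℝ} (ha : ∀ j, 0 < a j) {m : ℝ} (hm : 0 < m) {s : ℂ}
    (hs : (d : ℝ) / 2 < s.re) :
    HasMellin (fun t => (theta (torusLaplacian a m) t : ℂ)) s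
      (mellin (massiveDefect a m) s + heatCoeff a *
        ((1 / ((m ^ 2 : ℝ) : ℂ)) ^ (s - d / 2) * Complex.Gamma (s - d / 2))) := by
  have hre : 0 < (s + -(d / 2 : ℂ)).re := by
    have : (d / 2 : ℂ) = (((d : ℝ) / 2 : ℝ) : ℂ) := by push_cast; rfl
    rw [this, Complex.add_re, Complex.neg_re, Complex.ofReal_re]
    linarith
  have h1 := mellin_exp_neg_mul (pow_pos hm 2) hre
  have h2 : MellinConvergent (fun t : ℝ => (t : ℂ) ^ (-(d / 2 : ℂ)) •
      ((Real.exp (-(m ^ 2 * t)) : ℝ) : ℂ)) s := MellinConvergent.cpow_smul.2 h1.1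
  have h3 := hasMellin_add (mellin_massiveDefect ha hm s).1 (h2.const_smul (heatCoeff a : ℂ))
  rw [mellin_const_smul, mellin_cpow_smul, h1.2, ← sub_eq_add_neg] at h3
  refine ⟨?_, ?_⟩
  · refine IntegrableOn.congr_fun h3.1 (fun t ht => ?_) measurableSet_Ioi
    simp only
    rw [theta_eq_massiveDefect_add ha m ht]
  · rw [smul_eq_mul] at h3
    rw [← h3.2]
    refine setIntegral_congr_fun measurableSet_Ioi fun t ht => ?_
    simp only
    rw [theta_eq_massiveDefect_add ha m ht]

/-- The explicit continuation of the spectral zeta function. -/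
def continuedZeta (a : Fin d → ℝ) (m : ℝ) (s : ℂ) : ℂ :=
  (Complex.Gamma s)⁻¹ * mellin (massiveDefect a m) s +
    heatCoeff a * ((1 / ((m ^ 2 : ℝ) : ℂ)) ^ (s - d / 2) * gammaRatio d s)

theorem isTorusZeta_continuedZeta {a : Fin d → ℝ} (ha : ∀ j, 0 < a j) {m : ℝ} (hm : 0 < m) :
    IsTorusZeta a m (continuedZeta a m) := by
  have h1 : ∀ s, AnalyticAt ℂ (fun s => (Complex.Gamma s)⁻¹ * mellin (massiveDefect a m) s) s :=
    fun s => (analyticAt_inv_Gamma s).fun_mul (Differentiable.analyticAt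
      (fun s => (mellin_massiveDefect ha hm s).2) s)
  have hne : 1 / ((m ^ 2 : ℝ) : ℂ) ≠ 0 :=
    one_div_ne_zero (Complex.ofReal_ne_zero.2 (pow_pos hm 2).ne')
  have h2 : ∀ s, AnalyticAt ℂ (fun s : ℂ => (1 / ((m ^ 2 : ℝ) : ℂ)) ^ (s - d / 2)) s := fun s =>
    Differentiable.analyticAt (fun s => ((differentiableAt_id.sub_const _).const_cpow
      (Or.inl hne))) s
  refine ⟨fun s _ => ?_, ?_, fun s hs => ?_⟩
  · exact (h1 s).meromorphicAt.fun_add (analyticAt_const.meromorphicAt.fun_mul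
      ((h2 s).meromorphicAt.fun_mul (meromorphicAt_gammaRatio d s)))
  · exact (h1 0).fun_add (analyticAt_const.fun_mul ((h2 0).fun_mul (analyticAt_gammaRatio_zero d)))
  · rw [(hasMellin_theta ha hm hs).2, continuedZeta, gammaRatio_eq hs]
    ring

/-- The identity theorem: the difference has infinite order at $d/2+1$, hence everywhere on the
connected plane. It makes the choice behind `torusZeta` irrelevant at 0. -/
theorem IsTorusZeta.deriv_eq {a : Fin d → ℝ} {m : ℝ} {Z W : ℂ → ℂ} (hZ : IsTorusZeta a m Z)
    (hW : IsTorusZeta a m W) : deriv Z 0 = deriv W 0 := by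
  have hmer : MeromorphicOn (Z - W) univ := hZ.1.sub hW.1
  have htop : meromorphicOrderAt (Z - W) ((d : ℂ) / 2 + 1) = ⊤ := by
    rw [meromorphicOrderAt_eq_top_iff]
    refine Filter.Eventually.filter_mono nhdsWithin_le_nhds ?_
    have hopen : IsOpen {s : ℂ | (d : ℝ) / 2 < s.re} :=
      isOpen_lt continuous_const Complex.continuous_re
    have hmem : ((d : ℂ) / 2 + 1) ∈ {s : ℂ | (d : ℝ) / 2 < s.re} := by
      have : ((d : ℂ) / 2 + 1) = (((d : ℝ) / 2 + 1 : ℝ) : ℂ) := by push_cast; rfl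
      rw [this, mem_ofPred, Complex.ofReal_re]
      linarith
    filter_upwards [hopen.mem_nhds hmem] with s hs
    rw [Pi.sub_apply, hZ.2.2 s hs, hW.2.2 s hs, sub_self]
  have h0 : meromorphicOrderAt (Z - W) 0 = ⊤ := by
    by_contra h
    exact hmer.meromorphicOrderAt_ne_top_of_isPreconnected isPreconnected_univ (mem_univ _)
      (mem_univ _) h htop
  rw [meromorphicOrderAt_eq_top_iff] at h0
  -- Infinite order gives agreement only on a punctured neighbourhood; analyticity of both functions
  -- at 0 fills in the point.
  refine Filter.EventuallyEq.deriv_eq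
    ((hZ.2.1.frequently_eq_iff_eventually_eq hW.2.1).1 (h0.mono fun s hs => ?_).frequently)
  exact sub_eq_zero.1 hs

/-- As $1/\Gamma$ has a simple zero with derivative 1 at 0, the entire part contributes the value of
its Mellin transform, not its derivative. The rest is the product rule for $m^{d-2s}$ and the Gamma
quotient. -/
theorem deriv_continuedZeta {a : Fin d → ℝ} (ha : ∀ j, 0 < a j) {m : ℝ} (hm : 0 < m) :
    deriv (continuedZeta a m) 0 = mellin (massiveDefect a m) 0 + explicitTerm a m := by
  obtain ⟨r, hr, hE⟩ := exists_hasDerivAt_gammaRatio a hm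
  have hm2 : 0 < m ^ 2 := pow_pos hm 2
  have hne : 1 / ((m ^ 2 : ℝ) : ℂ) ≠ 0 := one_div_ne_zero (Complex.ofReal_ne_zero.2 hm2.ne')
  have h1 := hasDerivAt_inv_Gamma_zero.fun_mul (mellin_massiveDefect ha hm 0).2.hasDerivAt
  rw [Complex.Gamma_zero, inv_zero, zero_mul, add_zero, one_mul] at h1
  have h2 : HasDerivAt (fun s : ℂ => (1 / ((m ^ 2 : ℝ) : ℂ)) ^ (s - d / 2))
      ((1 / ((m ^ 2 : ℝ) : ℂ)) ^ ((0 : ℂ) - d / 2) * Complex.log (1 / ((m ^ 2 : ℝ) : ℂ)) * 1) 0 :=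
    ((hasDerivAt_id (0 : ℂ)).sub_const _).const_cpow (Or.inl hne)
  have h3 := h1.fun_add ((h2.fun_mul hr).const_mul (heatCoeff a : ℂ))
  have hbase : (1 / ((m ^ 2 : ℝ) : ℂ)) = (((m ^ 2)⁻¹ : ℝ) : ℂ) := by push_cast; rw [one_div]
  have hlog : Complex.log (1 / ((m ^ 2 : ℝ) : ℂ)) = -Real.log (m ^ 2) := by
    rw [hbase, ← Complex.ofReal_log (by positivity), Real.log_inv, Complex.ofReal_neg]
  have hpow : (1 / ((m ^ 2 : ℝ) : ℂ)) ^ ((0 : ℂ) - d / 2) = (m : ℂ) ^ d := by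
    have h4 : ((0 : ℂ) - d / 2) = ((-((d : ℝ) / 2) : ℝ) : ℂ) := by push_cast; ring
    rw [hbase, h4, ← Complex.ofReal_cpow (by positivity), Real.inv_rpow hm2.le,
      Real.rpow_neg hm2.le, inv_inv, Real.rpow_div_two_eq_sqrt _ hm2.le, Real.rpow_natCast,
      Real.sqrt_sq hm.le, Complex.ofReal_pow]
  unfold continuedZeta
  rw [h3.deriv, hlog, hpow, hE]
  ring

theorem torusLogDet_eq {a : Fin d → ℝ} (ha : ∀ j, 0 < a j) {m : ℝ} (hm : 0 < m) :
    torusLogDet a m = -(mellin (massiveDefect a m) 0 + explicitTerm a m) := by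
  have h := isTorusZeta_continuedZeta ha hm
  rw [torusLogDet, torusZeta, IsTorusZeta.deriv_eq (Classical.epsilon_spec ⟨_, h⟩) h,
    deriv_continuedZeta ha hm]

end Defect


/-! ### Passage to the limit in the remainder -/

section Limit

variable {d : ℕ}

theorem integrableOn_exp_mul_pow (d : ℕ) {c : ℝ} (hc : 0 < c) :
    IntegrableOn (fun t : ℝ => Real.exp (-(c * t)) * (1 + t) ^ d) (Ioi 0) := by
  refine integrable_of_isBigO_exp_neg (half_pos hc) (by fun_prop) ?_
  refine Asymptotics.IsBigO.trans ?_ (isBigO_poly_mul_exp d (half_lt_self hc))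
  refine Asymptotics.IsBigO.of_bound 1 ?_
  filter_upwards [eventually_ge_atTop 1] with t ht
  have h0 : 0 < t := by linarith
  rw [Real.norm_of_nonneg (by positivity), Real.norm_of_nonneg (by positivity), one_mul]
  refine mul_le_mul_of_nonneg_left ?_ (Real.exp_pos _).le
  exact le_mul_of_one_le_left (by positivity) ht

theorem measurable_discreteDefect (N : Fin d → ℕ) : Measurable (discreteDefect N) := by
  have h := measurable_latticeKernel
  unfold discreteDefect cycleTheta
  refine Measurable.sub ?_ ?_
  · exact Continuous.measurable (by fun_prop)
  · exact Finset.measurable_fun_prod _ fun j _ => h.const_mul _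

/-- The remainder after the parabolic rescaling `t ↦ u² t`. -/
theorem remainder_eq_rescaled (N : Fin d → ℕ) [∀ j, NeZero (N j)] (mu : ℝ) {u : ℝ} (hu : 0 < u) :
    remainder N mu = -∫ t in Ioi (0 : ℝ),
      Real.exp (-((u * mu) ^ 2 * t)) * discreteDefect N (u ^ 2 * t) / t := by
  -- The measure $dt/t$ is scale invariant: the Jacobian $u^2$ cancels against the denominator.
  have h := integral_comp_mul_left_Ioi (remainderIntegrand N mu) 0 (pow_pos hu 2)
  rw [mul_zero, smul_eq_mul, eq_inv_mul_iff_mul_eq₀ (pow_pos hu 2).ne', ← integral_const_mul] at h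
  rw [remainder, ← h]
  congr 2
  funext t
  rw [remainderIntegrand_eq_defect]
  have h2 : (u * mu) ^ 2 * t = mu ^ 2 * (u ^ 2 * t) := by ring
  rw [h2, ← mul_div_mul_left _ t (pow_pos hu 2).ne', mul_div_assoc']

theorem mellin_massiveDefect_zero (a : Fin d → ℝ) (m : ℝ) :
    mellin (massiveDefect a m) 0 =
      ((∫ t in Ioi (0 : ℝ), Real.exp (-(m ^ 2 * t)) * torusDefect a t / t : ℝ) : ℂ) := by
  rw [mellin, ← integral_complex_ofReal]
  refine setIntegral_congr_fun measurableSet_Ioi fun t _ => ?_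
  simp only [massiveDefect, zero_sub, Complex.cpow_neg_one, smul_eq_mul]
  push_cast
  ring

/-- The remainder converges to the regularized spectral integral of the torus. -/
theorem tendsto_remainder {a : Fin d → ℝ} (ha : ∀ j, 0 < a j) {m : ℝ} (hm : 0 < m)
    {N : ℝ → Fin d → ℕ} (hN : ∀ u, 0 < u → ∀ j, 0 < N u j)
    (hNa : ∀ j, Tendsto (fun u : ℝ => (N u j : ℝ) / u) atTop (𝓝 (a j))) {mt : ℝ → ℝ}
    (hmtm : Tendsto (fun u : ℝ => u * mt u) atTop (𝓝 m)) :
    Tendsto (fun u => remainder (N u) (mt u)) atTop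
      (𝓝 (-∫ t in Ioi (0 : ℝ), Real.exp (-(m ^ 2 * t)) * torusDefect a t / t)) := by
  -- One power of `t` suffices: it absorbs the $1/t$ of the measure.
  obtain ⟨C, hC, hbound⟩ := eventually_discreteDefect_le ha hN hNa 0
  have hm2 : 0 < m ^ 2 / 2 := by positivity
  have hmt2 : ∀ᶠ u in atTop, m ^ 2 / 2 ≤ (u * mt u) ^ 2 :=
    (hmtm.pow 2).eventually_const_le (half_lt_self (pow_pos hm 2))
  have h := tendsto_integral_filter_of_dominated_convergence (μ := volume.restrict (Ioi 0))
    (l := atTop) (F := fun (u t : ℝ) =>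
      Real.exp (-((u * mt u) ^ 2 * t)) * discreteDefect (N u) (u ^ 2 * t) / t)
    (f := fun t => Real.exp (-(m ^ 2 * t)) * torusDefect a t / t)
    (fun t => C * (Real.exp (-(m ^ 2 / 2 * t)) * (1 + t) ^ d)) ?_ ?_
    ((integrableOn_exp_mul_pow d hm2).const_mul C) ?_
  · refine h.neg.congr' ?_
    filter_upwards [eventually_gt_atTop 0] with u hu
    have : ∀ j, NeZero (N u j) := fun j => ⟨(hN u hu j).ne'⟩
    exact (remainder_eq_rescaled (N u) (mt u) hu).symm
  · refine Eventually.of_forall fun u => Measurable.aestronglyMeasurable ?_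
    have := measurable_discreteDefect (N u)
    fun_prop
  · filter_upwards [hbound, hmt2, eventually_gt_atTop 0] with u h1 h2 hu
    refine (ae_restrict_iff' measurableSet_Ioi).2 (Eventually.of_forall fun t ht => ?_)
    have ht : 0 < t := ht
    have : ∀ j, NeZero (N u j) := fun j => ⟨(hN u hu j).ne'⟩
    have h3 := discreteDefect_nonneg (N u) (by positivity : 0 ≤ u ^ 2 * t)
    have h4 := h1 t ht
    have h5 : Real.exp (-((u * mt u) ^ 2 * t)) ≤ Real.exp (-(m ^ 2 / 2 * t)) :=
      Real.exp_le_exp.2 (neg_le_neg (mul_le_mul_of_nonneg_right h2 ht.le))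
    rw [Real.norm_of_nonneg (by positivity), div_le_iff₀ ht]
    calc _ ≤ Real.exp (-(m ^ 2 / 2 * t)) * (C * t ^ (0 + 1) * (1 + t) ^ d) := by gcongr
      _ = _ := by ring
  · refine (ae_restrict_iff' measurableSet_Ioi).2 (Eventually.of_forall fun t ht => ?_)
    exact (((hmtm.pow 2).mul_const t).neg.rexp.mul (tendsto_discreteDefect ha hN hNa ht)).div_const t

end Limit

end MassiveTorus

end

/-! ### The factorization and the asymptotics -/

theorem theorem1p3 (d : ℕ) (hd : 1 ≤ d)
    (a : Fin d → ℝ) (ha : ∀ j, 0 < a j)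
    (m : ℝ) (hm : 0 < m)
    (N : ℝ → Fin d → ℕ) (hN : ∀ u, 0 < u → ∀ j, 0 < N u j)
    (hNa : ∀ j, Tendsto (fun u : ℝ => (N u j : ℝ) / u) atTop (𝓝 (a j)))
    (mt : ℝ → ℝ) (hmt : ∀ u, 0 < u → 0 < mt u)
    (hmtm : Tendsto (fun u : ℝ => u * mt u) atTop (𝓝 m)) :
    -- the exact factorization, with absolutely convergent integrals
    (∀ u, 0 < u →
      IntegrableOn (MassiveTorus.bulkIntegrand d (mt u)) (Ioi 0) ∧
      IntegrableOn (MassiveTorus.remainderIntegrand (N u) (mt u)) (Ioi 0) ∧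
      LinearMap.det (MassiveTorus.discreteLaplacian (N u) (mt u)) ≠ 0 ∧
      Complex.log (LinearMap.det (MassiveTorus.discreteLaplacian (N u) (mt u))) =
        (((∏ j, (N u j : ℝ)) * MassiveTorus.bulk d (mt u) +
          MassiveTorus.remainder (N u) (mt u) : ℝ) : ℂ)) ∧
    -- the zeta-regularized determinant of the torus is well defined
    (∀ lam : ℝ, FiniteDimensional ℂ
      ((MassiveTorus.torusLaplacian a m).eigenspace (lam : ℂ))) ∧
    (∀ t : ℝ, 0 < t → Summable fun lam : ℝ =>
      (Module.finrank ℂ ((MassiveTorus.torusLaplacian a m).eigenspace (lam : ℂ)) : ℝ) *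
        Real.exp (-(lam * t))) ∧
    (∀ s : ℂ, (d : ℝ) / 2 < s.re →
      MellinConvergent (fun t => (MassiveTorus.theta (MassiveTorus.torusLaplacian a m) t : ℂ)) s) ∧
    (∃ Z : ℂ → ℂ, MassiveTorus.IsTorusZeta a m Z) ∧
    -- the asymptotics of the remaining term
    Tendsto (fun u : ℝ => (MassiveTorus.remainder (N u) (mt u) : ℂ) -
        (MassiveTorus.torusLogDet a m + (MassiveTorus.explicitTerm a m : ℂ)))
      atTop (𝓝 0) := by
  have hNZ : ∀ u, 0 < u → ∀ j, NeZero (N u j) := fun u hu j => ⟨(hN u hu j).ne'⟩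
  refine ⟨fun u hu => ?_, fun lam => (MassiveTorus.eigenspace_torusLaplacian ha m lam).1,
    fun t ht => (MassiveTorus.hasSum_theta_torusLaplacian ha m ht).summable,
    fun s hs => (MassiveTorus.hasMellin_theta ha hm hs).1,
    ⟨_, MassiveTorus.isTorusZeta_continuedZeta ha hm⟩, ?_⟩
  · have := hNZ u hu
    exact ⟨MassiveTorus.integrableOn_bulkIntegrand d (hmt u hu),
      MassiveTorus.integrableOn_remainderIntegrand (N u) (hmt u hu),
      MassiveTorus.det_discreteLaplacian_ne_zero (N u) (hmt u hu),
      MassiveTorus.log_det_discreteLaplacian (N u) (hmt u hu)⟩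
  · have h := (Complex.continuous_ofReal.tendsto _).comp
      (MassiveTorus.tendsto_remainder ha hm hN hNa hmtm)
    -- The explicit term enters $-\zeta'(0)$ with a minus sign, so adding it leaves exactly the
    -- limit of the remainder.
    have h2 : MassiveTorus.torusLogDet a m + (MassiveTorus.explicitTerm a m : ℂ) =
        ((-∫ t in Ioi (0 : ℝ),
          Real.exp (-(m ^ 2 * t)) * MassiveTorus.torusDefect a t / t : ℝ) : ℂ) := by
      rw [MassiveTorus.torusLogDet_eq ha hm, MassiveTorus.mellin_massiveDefect_zero]
      push_cast
      ring
    rw [h2]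
    have h3 := h.sub_const ((-∫ t in Ioi (0 : ℝ),
      Real.exp (-(m ^ 2 * t)) * MassiveTorus.torusDefect a t / t : ℝ) : ℂ)
    rw [sub_self] at h3
    exact h3
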